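/- Let $\kappa,\lambda$ be real numbers with $0<\kappa\le \lambda/\sqrt e\le 1/(4\sqrt e)$. For an odd prime $p$ let $(\cdot|p)$ be the Legendre symbol, let $n_0(p)$ be the least positive integer $n$ with $(n|p)=-1$, and let $\mathscr N_p(X)=\{n\in\mathbb N: n\le X,\ (n|p)=-1\}$. Let $\mathscr P$ be an infinite set of odd primes such that $n_0(p)\ge p^{\kappa}$ for all $p\in\mathscr P$. Let ${\tt d}:\mathbb R\to[0,\infty)$ be a probability density that vanishes outside $[\kappa,\lambda]$, is twice continuously differentiable on $(\kappa,\lambda)$, and satisfies ${\tt d}(\kappa){\tt d}(\lambda)\neq0$. Put $\delta(\theta)=\frac12\int_0^\theta {\tt d}(u)\,du$, and assume that for every fixed $\theta\ge0$ $$\lim_{\substack{p\to\infty\\ p\in\mathscr P}}\frac{|\mathscr N_p(p^\theta)|}{p^\theta}=\delta(\theta).$$ Write $f*g$ for the convolution of functions on $\mathbb R$ and ${\tt d}^{*n}$ for the $n$-fold convolution of ${\tt d}$ with itself, with $\delta*{\tt d}^{*0}:=\delta$. Then: 1. For every $\theta\ge0$ the limit $$S_1(\theta):=\lim_{\substack{p\to\infty\\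 p\in\mathscr P}}\ \sum_{\substack{q\le p^\theta,\ q\text{ prime}\\ (q|p)=-1}}\frac1q$$ exists, is finite, and satisfies $$S_1(\theta)=\sum_{n=1}^\infty\frac{(\delta*{\tt d}^{*(n-1)})(\theta)}{n}.$$ 2. The function $S_1$ is continuously differentiable on $(\lambda,\infty)$, and $$S_1'(\theta)=\frac12\sum_{n=1}^\infty\frac{{\tt d}^{*n}(\theta)}{n}\qquad(\theta>\lambda).$$ Both series converge. -/

import Mathlib

open Filter Topology MeasureTheory

noncomputable section

/-- `(n|p) = -1`, where `(·|p)` is the Legendre symbol modulo the prime `p`. -/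
def IsNonresidueMod (p n : ℕ) : Prop :=
  ∃ hp : p.Prime, @legendreSym p ⟨hp⟩ (n : ℤ) = -1

/-- The least positive quadratic nonresidue modulo `p` (it exists for every odd prime `p`). -/
def leastNonresidue (p : ℕ) : ℕ := sInf {n : ℕ | 0 < n ∧ IsNonresidueMod p n}

open Classical in
/-- The set of natural numbers `n ≤ X` with `(n|p) = -1`. -/
def nonresiduesUpTo (p : ℕ) (X : ℝ) : Finset ℕ :=
  {n ∈ Finset.Icc 1 ⌊X⌋₊ | IsNonresidueMod p n}

open Classical in
/-- The sum of `1 / q` over the primes `q ≤ X` with `(q|p) = -1`. -/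
def nonresiduePrimeSum (p : ℕ) (X : ℝ) : ℝ :=
  ∑ q ∈ nonresiduesUpTo p X with q.Prime, (q : ℝ)⁻¹

/-- Convolution of real functions on the line, `(f * g)(x) = ∫ f(t) g(x - t) dt`. -/
def realConv (f g : ℝ → ℝ) : ℝ → ℝ :=
  convolution f g (ContinuousLinearMap.mul ℝ ℝ) volume

/-- `convPowSucc d n` is the convolution power `d^{*(n+1)}`. -/
def convPowSucc (d : ℝ → ℝ) : ℕ → ℝ → ℝ
  | 0 => d
  | n + 1 => realConv (convPowSucc d n) d

/-- `convWithPow f d n` is `f * d^{*n}`, where `d^{*0}` is the unit for convolution. -/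
def convWithPow (f d : ℝ → ℝ) : ℕ → ℝ → ℝ
  | 0 => f
  | n + 1 => realConv f (convPowSucc d n)

/-- The function `δ(θ) = ½ ∫₀^θ d(u) du`. -/
def halfCdf (d : ℝ → ℝ) (θ : ℝ) : ℝ := (1 / 2) * ∫ u in (0 : ℝ)..θ, d u

end

open Filter Topology MeasureTheory

/-! Put mass `1/q` at the point `log q / log p` for each prime nonresidue `q`. The sum in the
theorem is the mass of `(-∞, θ]`, and its limit is found by the continuity theorem for Laplace
transforms. Fix `s > 0` and let `w = 1 + s / log p`. By partial summation the counting hypothesis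
gives `(s / log p) L(w, χ_p) → 1 - F(s)`, where `F` is the Laplace transform of `d`
(`tendsto_L_div_log`), while `(s / log p) ζ(w) → 1`. By the Euler products, `log ζ(w) - log L(w,
χ_p)` is twice the Laplace transform of the point masses, up to an error `O(1/p)` and a tail of `∑
q⁻²` over `q ≥ p^κ` (`abs_log_zeta_sub_log_L_le`). So the transforms tend to `-½ log (1 - F) = ½ ∑
Fⁿ / n`, the transform of `½ ∑ d^{*n} / n`, and the limit is the integral of this density up to `θ`.
As `d^{*n}` vanishes below `nκ`, every series is locally a finite sum. Differentiating needs
continuity of the density beyond `lam`, hence a bounded `d`. Smoothness on the open interval does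
not give this. Chebyshev's bound does: primes in `(p^a, p^b]` carry reciprocal mass at most about
`log 4 · (b - a) / a`, so the limiting density, which is at least `½ d`, is bounded. -/

/-! ### Continuity theorem for moments and Laplace transforms. -/

theorem tendsto_tsum_continuous_of_moments {ι : Type*} {l : Filter ι} {w x : ι → ℕ → ℝ}
    (hw : ∀ᶠ a in l, ∀ n, 0 ≤ w a n) (hx : ∀ᶠ a in l, ∀ n, x a n ∈ Set.Icc (0 : ℝ) 1)
    (hs : ∀ᶠ a in l, Summable (w a)) {φ y : ℝ → ℝ} (hφ : Integrable φ)
    (hy : Measurable y) (hy1 : ∀ u, y u ∈ Set.Icc (0 : ℝ) 1)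
    (h : ∀ k : ℕ, Tendsto (fun a => ∑' n, w a n * x a n ^ k) l (𝓝 (∫ u, φ u * y u ^ k)))
    {g : ℝ → ℝ} (hg : Continuous g) :
    Tendsto (fun a => ∑' n, w a n * g (x a n)) l (𝓝 (∫ u, φ u * g (y u))) := by
  have hbd : ∀ f : ℝ → ℝ, Continuous f → ∃ C, ∀ t ∈ Set.Icc (0 : ℝ) 1, |f t| ≤ C := by
    intro f hf
    obtain ⟨C, hC⟩ := isCompact_Icc.exists_bound_of_continuousOn (s := Set.Icc (0 : ℝ) 1)
      hf.continuousOn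
    exact ⟨C, fun t ht => by simpa using hC t ht⟩
  have hsum : ∀ f : ℝ → ℝ, Continuous f → ∀ᶠ a in l, Summable fun n => w a n * f (x a n) := by
    intro f hf
    obtain ⟨C, hC⟩ := hbd f hf
    filter_upwards [hw, hx, hs] with a h1 h2 h3
    refine Summable.of_norm_bounded (h3.mul_right C) fun n => ?_
    rw [norm_mul, Real.norm_eq_abs, Real.norm_eq_abs, abs_of_nonneg (h1 n)]
    exact mul_le_mul_of_nonneg_left (hC _ (h2 n)) (h1 n)
  have hint : ∀ f : ℝ → ℝ, Continuous f → Integrable fun u => φ u * f (y u) := by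
    intro f hf
    obtain ⟨C, hC⟩ := hbd f hf
    refine hφ.mul_bdd (c := C) (hf.measurable.comp hy).aestronglyMeasurable ?_
    exact Eventually.of_forall fun u => by simpa using hC _ (hy1 u)
  have hpoly : ∀ q : Polynomial ℝ, Tendsto (fun a => ∑' n, w a n * q.eval (x a n)) l
      (𝓝 (∫ u, φ u * q.eval (y u))) := by
    intro q
    induction q using Polynomial.induction_on' with
    | add q₁ q₂ h₁ h₂ =>
      simp only [Polynomial.eval_add, mul_add]
      rw [integral_add (hint _ q₁.continuous) (hint _ q₂.continuous)]
      refine (h₁.add h₂).congr' ?_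
      filter_upwards [hsum _ q₁.continuous, hsum _ q₂.continuous] with a h3 h4
      rw [h3.tsum_add h4]
    | monomial k c =>
      simp only [Polynomial.eval_monomial]
      have := (h k).const_mul c
      rw [← integral_const_mul] at this
      simp only [← tsum_mul_left] at this
      simpa only [mul_left_comm] using this
  set A := ∫ u, |φ u| with hA
  have hA0 : 0 ≤ A := integral_nonneg fun u => abs_nonneg _
  -- The zeroth moment converges, so the total masses are eventually bounded and uniform
  -- approximation by a polynomial costs little.
  obtain ⟨B, hB⟩ : ∃ B, ∀ᶠ a in l, ∑' n, w a n ≤ B := by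
    have := h 0
    simp only [pow_zero, mul_one] at this
    refine ⟨_, (this.eventually_lt_const (lt_add_one _)).mono fun a ha => ha.le⟩
  rw [Metric.tendsto_nhds]
  intro ε hε
  obtain ⟨η, hη, hη1⟩ : ∃ η : ℝ, 0 < η ∧ η * (|B| + A) ≤ ε / 2 := by
    refine ⟨ε / 2 / (|B| + A + 1), by positivity, ?_⟩
    rw [div_mul_eq_mul_div, div_le_iff₀ (by positivity)]
    exact mul_le_mul_of_nonneg_left (by linarith) (by positivity)
  obtain ⟨q, hq⟩ := exists_polynomial_near_of_continuousOn 0 1 g hg.continuousOn η hη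
  have hI : |(∫ u, φ u * g (y u)) - ∫ u, φ u * q.eval (y u)| ≤ η * A := by
    rw [← integral_sub (hint _ hg) (hint _ q.continuous), hA, ← integral_const_mul]
    refine (norm_integral_le_integral_norm _).trans
      (integral_mono ((hint _ hg).sub (hint _ q.continuous)).norm (hφ.abs.const_mul _) fun u => ?_)
    simp only [Real.norm_eq_abs, Pi.sub_apply]
    rw [← mul_sub, abs_mul, mul_comm, abs_sub_comm]
    exact mul_le_mul_of_nonneg_right (hq _ (hy1 u)).le (abs_nonneg _)
  filter_upwards [hw, hx, hs, hB, hsum _ hg, hsum _ q.continuous,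
    (Metric.tendsto_nhds.1 (hpoly q)) (ε / 2) (by positivity)] with a h1 h2 h3 h4 h5 h6 h7
  have hS : |(∑' n, w a n * g (x a n)) - ∑' n, w a n * q.eval (x a n)| ≤ η * |B| := by
    rw [← h5.tsum_sub h6]
    refine (norm_tsum_le_tsum_norm (f := fun n => w a n * g (x a n) - w a n * q.eval (x a n))
      (h5.sub h6).norm).trans ?_
    calc _ ≤ ∑' n, η * w a n := by
          refine (h5.sub h6).norm.tsum_le_tsum (fun n => ?_) (h3.mul_left _)
          rw [← mul_sub, norm_mul, Real.norm_eq_abs, abs_of_nonneg (h1 n), mul_comm,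
            Real.norm_eq_abs, abs_sub_comm]
          exact mul_le_mul_of_nonneg_right (hq _ (h2 n)).le (h1 n)
      _ ≤ _ := by
          rw [tsum_mul_left]
          exact mul_le_mul_of_nonneg_left (h4.trans (le_abs_self _)) hη.le
  rw [Real.dist_eq] at h7 ⊢
  rw [abs_le] at hS hI
  rw [abs_lt] at h7 ⊢
  constructor <;> nlinarith

theorem tendsto_tsum_compact_of_laplace {ι : Type*} {l : Filter ι} {W v : ι → ℕ → ℝ}
    (hW : ∀ᶠ a in l, ∀ n, 0 ≤ W a n) (hv : ∀ᶠ a in l, ∀ n, 0 ≤ v a n)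
    (hs : ∀ᶠ a in l, Summable fun n => W a n * Real.exp (-v a n)) {ψ : ℝ → ℝ}
    (hψ0 : ∀ u < 0, ψ u = 0) (hψ : Integrable fun u => ψ u * Real.exp (-u))
    (h : ∀ s : ℝ, 0 < s → Tendsto (fun a => ∑' n, W a n * Real.exp (-(s * v a n))) l
      (𝓝 (∫ u, ψ u * Real.exp (-(s * u)))))
    {r : ℝ → ℝ} (hr : Continuous r) {b : ℝ} (hb : ∀ u, b ≤ u → r u = 0) :
    Tendsto (fun a => ∑' n, W a n * r (v a n)) l (𝓝 (∫ u, ψ u * r u)) := by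
  -- A continuous inverse of `u ↦ exp (-u)`, truncated at height `b`. The truncation is harmless
  -- because `r` vanishes from `b` on.
  set ell : ℝ → ℝ := fun t => -Real.log (max t (Real.exp (-b))) with hell
  have hellc : Continuous ell :=
    ((continuous_id.max continuous_const).log fun t =>
      (lt_max_of_lt_right (Real.exp_pos _)).ne').neg
  have hellu : ∀ u, ell (Real.exp (-u)) = min u b := by
    intro u
    have : max (Real.exp (-u)) (Real.exp (-b)) = Real.exp (-(min u b)) := by
      rw [← Real.exp_monotone.map_max, max_neg_neg]
    simp only [hell, this, Real.log_exp, neg_neg]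
  have hkey : ∀ u, Real.exp (-u) * (Real.exp (ell (Real.exp (-u))) * r (ell (Real.exp (-u)))) = r u := by
    intro u
    rw [hellu]
    rcases le_total u b with hu | hu
    · rw [min_eq_left hu, ← mul_assoc, ← Real.exp_add]; simp
    · rw [min_eq_right hu, hb b le_rfl, hb u hu]; simp
  have hab : ∀ u, ψ u = 0 ∨ |u| = u := by
    intro u
    rcases lt_or_ge u 0 with hu | hu
    · exact Or.inl (hψ0 u hu)
    · exact Or.inr (abs_of_nonneg hu)
  -- Tilting by `exp (-v)` makes the masses finite, and the `k`-th moment in `exp (-v)` is then the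
  -- Laplace transform at `k + 1`. The absolute value in `y` keeps it in `[0, 1]` for negative `u`,
  -- where `ψ` is zero.
  have := tendsto_tsum_continuous_of_moments (l := l) (w := fun a n => W a n * Real.exp (-v a n))
    (x := fun a n => Real.exp (-v a n)) (φ := fun u => ψ u * Real.exp (-u))
    (y := fun u : ℝ => Real.exp (-|u|)) (hW.mono fun a ha n => mul_nonneg (ha n) (Real.exp_pos _).le)
    (hv.mono fun a ha n => ⟨(Real.exp_pos _).le, by simpa using ha n⟩) hs hψ
    (by fun_prop) (fun u => ⟨(Real.exp_pos _).le, by simp⟩)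
    (fun k => by
      convert! h (k + 1) (by positivity) using 3
      · funext n
        rw [← Real.exp_nat_mul, mul_assoc, ← Real.exp_add]; ring_nf
      · ext u
        rcases hab u with hu | hu
        · simp [hu]
        · rw [hu, ← Real.exp_nat_mul, mul_assoc, ← Real.exp_add]; ring_nf)
    (g := fun t => Real.exp (ell t) * r (ell t)) (by fun_prop)
  convert! this using 3
  · funext n
    rw [mul_assoc, hkey]
  · ext u
    rcases hab u with hu | hu
    · simp [hu]
    · rw [hu, mul_assoc, hkey]

/-- The indicator of `(-∞, θ]` lies between ramps falling on `[θ - ε, θ]` and on `[θ, θ + ε]`. The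
limit has a density, hence no atom at `θ`, so both ramp integrals tend to the same value as `ε → 0`.
-/
theorem tendsto_tsum_le_of_laplace {ι : Type*} {l : Filter ι} {W v : ι → ℕ → ℝ}
    (hW : ∀ᶠ a in l, ∀ n, 0 ≤ W a n) (hv : ∀ᶠ a in l, ∀ n, 0 ≤ v a n)
    (hs : ∀ᶠ a in l, Summable fun n => W a n * Real.exp (-v a n)) {ψ : ℝ → ℝ}
    (hψ0 : ∀ u < 0, ψ u = 0) (hψ : Integrable fun u => ψ u * Real.exp (-u))
    (h : ∀ s : ℝ, 0 < s → Tendsto (fun a => ∑' n, W a n * Real.exp (-(s * v a n))) l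
      (𝓝 (∫ u, ψ u * Real.exp (-(s * u))))) (θ : ℝ) :
    Tendsto (fun a => ∑' n, if v a n ≤ θ then W a n else 0) l (𝓝 (∫ u in Set.Iic θ, ψ u)) := by
  -- a ramp equal to `1` before `c` and `0` after `c + ε`
  set ramp : ℝ → ℝ → ℝ → ℝ := fun ε c u => max 0 (min 1 ((c + ε - u) / ε)) with hramp
  have hrc : ∀ ε c, Continuous (ramp ε c) := fun ε c => by simp only [hramp]; fun_prop
  have hr0 : ∀ ε c u, 0 ≤ ramp ε c u := fun ε c u => le_max_left _ _
  have hr1 : ∀ ε c u, ramp ε c u ≤ 1 := fun ε c u => max_le zero_le_one (min_le_left _ _)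
  have hrone : ∀ ε c u, 0 < ε → u ≤ c → ramp ε c u = 1 := fun ε c u hε hu => by
    have : 1 ≤ (c + ε - u) / ε := by rw [le_div_iff₀ hε]; linarith
    simp [hramp, this]
  have hrzero : ∀ ε c u, 0 < ε → c + ε ≤ u → ramp ε c u = 0 := fun ε c u hε hu => by
    have : (c + ε - u) / ε ≤ 0 := div_nonpos_of_nonpos_of_nonneg (by linarith) hε.le
    simp only [hramp]
    exact max_eq_left ((min_le_right _ _).trans this)
  set e : ℕ → ℝ := fun n => 1 / ((n : ℝ) + 1) with he
  have he0 : ∀ n, 0 < e n := fun n => by simp only [he]; positivity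
  have he1 : ∀ n, e n ≤ 1 := fun n => by
    simp only [he]; rw [div_le_one (by positivity)]; linarith [n.cast_nonneg (α := ℝ)]
  have het : Tendsto e atTop (𝓝 0) := tendsto_one_div_add_atTop_nhds_zero_nat
  -- dominated convergence for the ramps
  have hdom : ∀ c : ℕ → ℝ, (∀ n, c n = θ ∨ c n = θ - e n) →
      Tendsto (fun n => ∫ u, ψ u * ramp (e n) (c n) u) atTop (𝓝 (∫ u in Set.Iic θ, ψ u)) := by
    intro c hc
    have hcl : Tendsto c atTop (𝓝 θ) := by
      refine tendsto_of_tendsto_of_tendsto_of_le_of_le (g := fun n => θ - e n) (h := fun _ => θ)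
        (by simpa using tendsto_const_nhds.sub het) tendsto_const_nhds ?_ ?_ <;> intro n <;>
        rcases hc n with h | h <;> simp only [h] <;> linarith [he0 n]
    rw [← integral_indicator measurableSet_Iic]
    have hψm : AEStronglyMeasurable ψ := by
      have := hψ.aestronglyMeasurable.mul
        (Real.continuous_exp.aestronglyMeasurable (μ := (volume : Measure ℝ)))
      refine this.congr (Eventually.of_forall fun u => ?_)
      simp [mul_assoc, ← Real.exp_add]
    refine tendsto_integral_of_dominated_convergence
      -- All ramps vanish beyond `θ + 1`, and before that point `exp (θ + 1 - u) ≥ 1`.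
      (fun u => Real.exp (θ + 1) * |ψ u * Real.exp (-u)|)
      (fun n => hψm.mul (hrc _ _).aestronglyMeasurable) (hψ.abs.const_mul _)
      (fun n => Eventually.of_forall fun u => ?_) ?_
    · rw [norm_mul, Real.norm_eq_abs, Real.norm_eq_abs, abs_of_nonneg (hr0 _ _ _), abs_mul,
        Real.abs_exp, mul_left_comm, ← Real.exp_add]
      refine mul_le_mul_of_nonneg_left ?_ (abs_nonneg _)
      rcases le_total u (θ + 1) with hu | hu
      · exact (hr1 _ _ _).trans (Real.one_le_exp (by linarith))
      · rw [hrzero _ _ _ (he0 n)]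
        · positivity
        · rcases hc n with h | h <;> rw [h] <;> linarith [he1 n]
    · have : ∀ᵐ u : ℝ, u ≠ θ := Measure.ae_ne volume θ
      filter_upwards [this] with u hu
      rcases lt_or_gt_of_ne hu with hu | hu
      · rw [Set.indicator_of_mem (Set.mem_Iic.2 hu.le)]
        refine tendsto_const_nhds.congr' ?_
        filter_upwards [hcl.eventually_const_lt hu] with n hn
        rw [hrone _ _ _ (he0 n) hn.le, mul_one]
      · rw [Set.indicator_of_notMem (by simpa using hu)]
        refine tendsto_const_nhds.congr' ?_
        have := hcl.add het
        rw [add_zero] at this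
        filter_upwards [this.eventually_lt_const hu] with n hn
        rw [hrzero _ _ _ (he0 n) hn.le, mul_zero]
  have hsr : ∀ n c, ∀ᶠ a in l, Summable fun k => W a k * ramp (e n) c (v a k) := by
    intro n c
    filter_upwards [hW, hs] with a h1 h2
    refine Summable.of_nonneg_of_le (fun k => mul_nonneg (h1 k) (hr0 _ _ _)) (fun k => ?_)
      (h2.mul_left (Real.exp (c + e n)))
    rw [mul_left_comm, ← Real.exp_add]
    refine mul_le_mul_of_nonneg_left ?_ (h1 k)
    rcases le_total (v a k) (c + e n) with hu | hu
    · exact (hr1 _ _ _).trans (Real.one_le_exp (by linarith))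
    · rw [hrzero _ _ _ (he0 n) hu]; positivity
  have hsi : ∀ᶠ a in l, Summable fun k => if v a k ≤ θ then W a k else 0 := by
    filter_upwards [hW, hs] with a h1 h2
    refine Summable.of_nonneg_of_le (fun k => ?_) (fun k => ?_) (h2.mul_left (Real.exp θ))
    · split_ifs
      exacts [h1 k, le_rfl]
    · rw [mul_left_comm, ← Real.exp_add]
      split_ifs with hu
      · exact le_mul_of_one_le_right (h1 k) (Real.one_le_exp (by linarith))
      · exact mul_nonneg (h1 k) (Real.exp_pos _).le
  have hlim : ∀ n c, Tendsto (fun a => ∑' k, W a k * ramp (e n) c (v a k)) l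
      (𝓝 (∫ u, ψ u * ramp (e n) c u)) := fun n c =>
    tendsto_tsum_compact_of_laplace hW hv hs hψ0 hψ h (hrc _ _)
      fun u hu => hrzero _ _ _ (he0 n) hu
  refine tendsto_order.2 ⟨fun A hA => ?_, fun A hA => ?_⟩
  · obtain ⟨n, hn⟩ := ((hdom (fun n => θ - e n) fun n => Or.inr rfl).eventually_const_lt hA).exists
    filter_upwards [(hlim n (θ - e n)).eventually_const_lt hn, hW, hsi, hsr n (θ - e n)]
      with a h1 h2 h3 h4
    refine h1.trans_le (h4.tsum_le_tsum (fun k => ?_) h3)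
    split_ifs with hu
    · exact mul_le_of_le_one_right (h2 k) (hr1 _ _ _)
    · rw [hrzero _ _ _ (he0 n) (by linarith), mul_zero]
  · obtain ⟨n, hn⟩ := ((hdom (fun n => θ) fun n => Or.inl rfl).eventually_lt_const hA).exists
    filter_upwards [(hlim n θ).eventually_lt_const hn, hW, hsi, hsr n θ] with a h1 h2 h3 h4
    refine (h3.tsum_le_tsum (fun k => ?_) h4).trans_lt h1
    split_ifs with hu
    · rw [hrone _ _ _ (he0 n) hu, mul_one]
    · exact mul_nonneg (h2 k) (hr0 _ _ _)

/-! ### Convolution on the line. -/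

theorem realConv_apply (f g : ℝ → ℝ) (x : ℝ) : realConv f g x = ∫ t, f t * g (x - t) := rfl

theorem realConv_nonneg {f g : ℝ → ℝ} (hf : ∀ x, 0 ≤ f x) (hg : ∀ x, 0 ≤ g x) (x : ℝ) :
    0 ≤ realConv f g x :=
  integral_nonneg fun t => mul_nonneg (hf t) (hg (x - t))

theorem realConv_eq_zero_of_lt {f g : ℝ → ℝ} {a b : ℝ} (hf : ∀ x < a, f x = 0)
    (hg : ∀ x < b, g x = 0) {x : ℝ} (hx : x < a + b) : realConv f g x = 0 := by
  rw [realConv_apply]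
  refine integral_eq_zero_of_ae (Eventually.of_forall fun t => ?_)
  rcases lt_or_ge t a with ht | ht
  · simp [hf t ht]
  · simp [hg (x - t) (by linarith)]

theorem realConv_mul_exp (f g : ℝ → ℝ) (s : ℝ) :
    realConv (fun u => f u * Real.exp (-(s * u))) (fun u => g u * Real.exp (-(s * u))) =
      fun u => realConv f g u * Real.exp (-(s * u)) := by
  ext x
  simp only [realConv_apply]
  rw [← integral_mul_const]
  congr 1
  ext t
  rw [mul_mul_mul_comm, ← Real.exp_add]
  ring_nf

theorem integrable_realConv {f g : ℝ → ℝ} (hf : Integrable f) (hg : Integrable g) :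
    Integrable (realConv f g) :=
  hf.integrable_convolution _ hg

theorem integral_realConv {f g : ℝ → ℝ} (hf : Integrable f) (hg : Integrable g) :
    ∫ x, realConv f g x = (∫ x, f x) * ∫ x, g x :=
  integral_convolution (ContinuousLinearMap.mul ℝ ℝ) hf hg

/-- Fubini. This identifies `δ * d^{*n}` with half the distribution function of `d^{*(n+1)}`. -/
theorem setIntegral_Iic_realConv {f g : ℝ → ℝ} (hf : Integrable f) (hg : Integrable g) (θ : ℝ) :
    ∫ x in Set.Iic θ, realConv f g x = ∫ t, f t * ∫ y in Set.Iic (θ - t), g y := by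
  have h1 : Integrable (fun q : ℝ × ℝ => f q.2 * g (q.1 - q.2))
      ((volume.restrict (Set.Iic θ)).prod volume) := by
    have := (hf.convolution_integrand (ContinuousLinearMap.mul ℝ ℝ) hg).restrict
      (s := Set.Iic θ ×ˢ Set.univ)
    rwa [← Measure.prod_restrict, Measure.restrict_univ] at this
  simp only [realConv_apply]
  rw [integral_integral_swap (f := fun x t => f t * g (x - t)) h1]
  congr 1
  ext t
  rw [integral_const_mul]
  congr 1
  rw [← integral_indicator measurableSet_Iic, ← integral_indicator measurableSet_Iic,
    ← integral_sub_right_eq_self ((Set.Iic (θ - t)).indicator g) t]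
  congr 1
  ext x
  simp [Set.indicator]

/-- Dominated convergence: the translates of the countable exceptional set are null. The exceptions
allow the jumps of `d` at the ends of its support. -/
theorem continuous_realConv {f g : ℝ → ℝ} (hf : Integrable f) (hg : AEStronglyMeasurable g)
    {M : ℝ} (hM : ∀ x, |g x| ≤ M) {s : Set ℝ} (hs : s.Countable)
    (hc : ∀ x ∉ s, ContinuousAt g x) : Continuous (realConv f g) := by
  refine continuous_iff_continuousAt.2 fun x₀ => ?_
  change ContinuousAt (fun x => ∫ t, f t * g (x - t)) x₀
  refine continuousAt_of_dominated (bound := fun t => |f t| * M) ?_ ?_ (hf.abs.mul_const M) ?_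
  · refine Eventually.of_forall fun x => hf.aestronglyMeasurable.mul ?_
    exact hg.comp_quasiMeasurePreserving (quasiMeasurePreserving_sub_left volume x)
  · refine Eventually.of_forall fun x => Eventually.of_forall fun t => ?_
    rw [norm_mul, Real.norm_eq_abs, Real.norm_eq_abs]
    exact mul_le_mul_of_nonneg_left (hM _) (abs_nonneg _)
  · have hs' : ((fun t => x₀ - t) '' s).Countable := hs.image _
    filter_upwards [hs'.ae_notMem volume] with t ht
    have : x₀ - t ∉ s := fun h => ht ⟨x₀ - t, h, by simp⟩
    refine continuousAt_const.mul ?_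
    exact ContinuousAt.comp (f := fun x => x - t) (hc _ this) (by fun_prop)

/-- The Laplace transform of `d` at `s`. -/
noncomputable def laplaceReal (d : ℝ → ℝ) (s : ℝ) : ℝ := ∫ u, d u * Real.exp (-(s * u))

/-- The logarithmic density `½ ∑ d^{*n} / n`. -/
noncomputable def logConvDensity (d : ℝ → ℝ) (u : ℝ) : ℝ :=
  (1 / 2) * ∑' n : ℕ, convPowSucc d n u / ((n : ℝ) + 1)

/-! ### Convolution powers of the density and their logarithmic sum. -/

section

variable {d : ℝ → ℝ} {κ lam : ℝ}

theorem convPowSucc_nonneg (hd : ∀ x, 0 ≤ d x) : ∀ (n : ℕ) (x : ℝ), 0 ≤ convPowSucc d n x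
  | 0 => hd
  | n + 1 => realConv_nonneg (convPowSucc_nonneg hd n) hd

theorem convPowSucc_eq_zero (h0 : ∀ x < κ, d x = 0) :
    ∀ (n : ℕ), ∀ x < (n + 1) * κ, convPowSucc d n x = 0
  | 0 => by simpa [convPowSucc] using h0
  | n + 1 => fun x hx => realConv_eq_zero_of_lt (convPowSucc_eq_zero h0 n) h0
      (by push_cast at hx; linarith)

theorem integrable_convPowSucc (hi : Integrable d) : ∀ n : ℕ, Integrable (convPowSucc d n)
  | 0 => hi
  | n + 1 => integrable_realConv (integrable_convPowSucc hi n) hi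

theorem integrable_mul_exp (hκ : 0 < κ) (h0 : ∀ x < κ, d x = 0) (hi : Integrable d) {s : ℝ}
    (hs : 0 ≤ s) : Integrable fun u => d u * Real.exp (-(s * u)) := by
  refine hi.mono (hi.aestronglyMeasurable.mul (by fun_prop)) (Eventually.of_forall fun u => ?_)
  rw [norm_mul, Real.norm_eq_abs, Real.norm_eq_abs, Real.abs_exp]
  rcases lt_or_ge u κ with hu | hu
  · simp [h0 u hu]
  · refine mul_le_of_le_one_right (abs_nonneg _) ?_
    simpa using mul_nonneg hs (hκ.le.trans hu)

theorem laplaceReal_pos (hκ : 0 < κ) (h0 : ∀ x < κ, d x = 0) (hd : ∀ x, 0 ≤ d x)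
    (hi : Integrable d) (h1 : ∫ x, d x = 1) {s : ℝ} (hs : 0 ≤ s) : 0 < laplaceReal d s := by
  have h2 : 0 < volume (Function.support d) :=
    (integral_pos_iff_support_of_nonneg hd hi).1 (h1 ▸ one_pos)
  refine (integral_pos_iff_support_of_nonneg
    (fun u => mul_nonneg (hd u) (Real.exp_pos _).le) (integrable_mul_exp hκ h0 hi hs)).2 ?_
  convert! h2 using 2
  ext u
  simp

theorem laplaceReal_lt_one (hκ : 0 < κ) (h0 : ∀ x < κ, d x = 0) (hd : ∀ x, 0 ≤ d x)
    (hi : Integrable d) (h1 : ∫ x, d x = 1) {s : ℝ} (hs : 0 < s) : laplaceReal d s < 1 := by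
  calc laplaceReal d s ≤ ∫ u, d u * Real.exp (-(s * κ)) := by
        refine integral_mono (integrable_mul_exp hκ h0 hi hs.le) (hi.mul_const _) fun u => ?_
        rcases lt_or_ge u κ with hu | hu
        · simp [h0 u hu]
        · refine mul_le_mul_of_nonneg_left (Real.exp_le_exp.2 ?_) (hd u)
          have := mul_le_mul_of_nonneg_left hu hs.le
          linarith
    _ = Real.exp (-(s * κ)) := by rw [integral_mul_const, h1, one_mul]
    _ < 1 := by simpa using mul_pos hs hκ

theorem integrable_convPowSucc_mul_exp (hκ : 0 < κ) (h0 : ∀ x < κ, d x = 0) (hi : Integrable d)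
    {s : ℝ} (hs : 0 ≤ s) (n : ℕ) : Integrable fun u => convPowSucc d n u * Real.exp (-(s * u)) := by
  refine integrable_mul_exp (κ := (n + 1) * κ) (by positivity) (convPowSucc_eq_zero h0 n)
    (integrable_convPowSucc hi n) hs

theorem integral_convPowSucc_mul_exp (hκ : 0 < κ) (h0 : ∀ x < κ, d x = 0) (hi : Integrable d)
    {s : ℝ} (hs : 0 ≤ s) (n : ℕ) :
    ∫ u, convPowSucc d n u * Real.exp (-(s * u)) = laplaceReal d s ^ (n + 1) := by
  induction n with
  | zero => simp [convPowSucc, laplaceReal]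
  | succ n ih =>
    rw [pow_succ, ← ih, laplaceReal, ← integral_realConv
      (integrable_convPowSucc_mul_exp hκ h0 hi hs n) (integrable_mul_exp hκ h0 hi hs),
      realConv_mul_exp]
    rfl

theorem summable_convPowSucc (hκ : 0 < κ) (h0 : ∀ x < κ, d x = 0) (u : ℝ) :
    Summable fun n : ℕ => convPowSucc d n u / ((n : ℝ) + 1) := by
  -- Terms with index at least `K` vanish at `u`, since `u < Kκ`. The same cut makes the later
  -- series finite.
  obtain ⟨K, hK⟩ := exists_nat_gt (u / κ)
  rw [div_lt_iff₀ hκ] at hK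
  refine summable_of_ne_finset_zero (s := Finset.range K) fun n hn => ?_
  rw [convPowSucc_eq_zero h0 n, zero_div]
  have : (K : ℝ) ≤ n := by exact_mod_cast not_lt.1 fun h => hn (Finset.mem_range.2 h)
  nlinarith

theorem logConvDensity_eq_zero (h0 : ∀ x < κ, d x = 0) (hκ : 0 < κ) {u : ℝ} (hu : u < κ) :
    logConvDensity d u = 0 := by
  have : ∀ n : ℕ, convPowSucc d n u / ((n : ℝ) + 1) = 0 := fun n => by
    rw [convPowSucc_eq_zero h0 n, zero_div]
    nlinarith [n.cast_nonneg (α := ℝ)]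
  simp [logConvDensity, this]

theorem half_le_logConvDensity (hκ : 0 < κ) (h0 : ∀ x < κ, d x = 0) (hd : ∀ x, 0 ≤ d x) (u : ℝ) :
    (1 / 2) * d u ≤ logConvDensity d u := by
  have := (summable_convPowSucc hκ h0 u).le_tsum 0 fun n _ =>
    div_nonneg (convPowSucc_nonneg hd n u) (by positivity)
  simp only [convPowSucc, CharP.cast_eq_zero, zero_add, div_one] at this
  exact mul_le_mul_of_nonneg_left this (by norm_num)

theorem integral_logConvDensity_mul_exp (hκ : 0 < κ) (h0 : ∀ x < κ, d x = 0)
    (hd : ∀ x, 0 ≤ d x) (hi : Integrable d) (h1 : ∫ x, d x = 1) {s : ℝ} (hs : 0 < s) :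
    Integrable (fun u => logConvDensity d u * Real.exp (-(s * u))) ∧
    ∫ u, logConvDensity d u * Real.exp (-(s * u)) = -(1 / 2) * Real.log (1 - laplaceReal d s) := by
  set G : ℕ → ℝ → ℝ := fun n u =>
    (1 / 2) * (convPowSucc d n u / ((n : ℝ) + 1)) * Real.exp (-(s * u)) with hG
  have hGe : ∀ n, G n = fun u => (1 / 2) / ((n : ℝ) + 1) *
      (convPowSucc d n u * Real.exp (-(s * u))) := fun n => by ext u; simp only [hG]; ring
  have hGi : ∀ n, Integrable (G n) := fun n => by
    rw [hGe]; exact (integrable_convPowSucc_mul_exp hκ h0 hi hs.le n).const_mul _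
  have hGI : ∀ n, ∫ u, G n u = (1 / 2) * (laplaceReal d s ^ (n + 1) / ((n : ℝ) + 1)) := fun n => by
    rw [hGe, integral_const_mul, integral_convPowSucc_mul_exp hκ h0 hi hs.le]; ring
  have hG0 : ∀ n u, 0 ≤ G n u := fun n u => by
    have := convPowSucc_nonneg hd n u
    simp only [hG]; positivity
  have hlog := (Real.hasSum_pow_div_log_of_abs_lt_one (x := laplaceReal d s) (by
    rw [abs_of_nonneg (laplaceReal_pos hκ h0 hd hi h1 hs.le).le]
    exact laplaceReal_lt_one hκ h0 hd hi h1 hs)).mul_left (1 / 2)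
  have hsum : Summable fun n => ∫ u, ‖G n u‖ := by
    refine hlog.summable.congr fun n => ?_
    rw [← hGI]
    simp [abs_of_nonneg (hG0 n _)]
  have hpt : ∀ u, ∑' n, G n u = logConvDensity d u * Real.exp (-(s * u)) := fun u => by
    simp only [hG, logConvDensity, tsum_mul_right, tsum_mul_left]
  have hI := hasSum_integral_of_summable_integral_norm hGi hsum
  simp only [hpt, hGI] at hI
  have hI' := hlog.unique hI
  -- A non-integrable function has integral `0` by convention. The value `-½ log (1 - F(s))` is
  -- positive because `0 < F(s) < 1`, so integrability follows.
  refine ⟨not_imp_comm.1 integral_undef ?_, by rw [← hI']; ring⟩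
  rw [← hI']
  have h3 := laplaceReal_pos hκ h0 hd hi h1 hs.le
  have h4 := laplaceReal_lt_one hκ h0 hd hi h1 hs
  have := Real.log_neg (sub_pos.2 h4) (by linarith)
  linarith

theorem integrableOn_logConvDensity (hκ : 0 < κ) (h0 : ∀ x < κ, d x = 0)
    (hd : ∀ x, 0 ≤ d x) (hi : Integrable d) (h1 : ∫ x, d x = 1) (θ : ℝ) :
    IntegrableOn (logConvDensity d) (Set.Iic θ) := by
  have h2 := (integral_logConvDensity_mul_exp hκ h0 hd hi h1 one_pos).1
  have h3 : Integrable (fun u => logConvDensity d u * Real.exp (-(1 * u)) * Real.exp u)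
      (volume.restrict (Set.Iic θ)) := by
    refine h2.restrict.mul_bdd (c := Real.exp θ)
      Real.continuous_exp.aestronglyMeasurable ?_
    filter_upwards [ae_restrict_mem measurableSet_Iic] with u hu
    simpa using hu
  refine h3.congr (Eventually.of_forall fun u => ?_)
  simp [mul_assoc, ← Real.exp_add]

theorem hasSum_setIntegral_convPowSucc (hκ : 0 < κ) (h0 : ∀ x < κ, d x = 0)
    (hi : Integrable d) (θ : ℝ) :
    HasSum (fun n : ℕ => (1 / 2) * (∫ u in Set.Iic θ, convPowSucc d n u) / ((n : ℝ) + 1))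
      (∫ u in Set.Iic θ, logConvDensity d u) := by
  obtain ⟨K, hK⟩ := exists_nat_gt (θ / κ)
  rw [div_lt_iff₀ hκ] at hK
  have hz : ∀ n ∉ Finset.range K, ∀ u ∈ Set.Iic θ, convPowSucc d n u = 0 := by
    intro n hn u hu
    have : (K : ℝ) ≤ n := by exact_mod_cast not_lt.1 fun h => hn (Finset.mem_range.2 h)
    refine convPowSucc_eq_zero h0 n _ (hu.trans_lt ?_)
    nlinarith
  have h2 : ∫ u in Set.Iic θ, logConvDensity d u =
      ∑ n ∈ Finset.range K, (1 / 2) * (∫ u in Set.Iic θ, convPowSucc d n u) / ((n : ℝ) + 1) := by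
    simp only [mul_div_assoc, ← integral_div, ← integral_const_mul]
    rw [← integral_finsetSum]
    · refine setIntegral_congr_fun measurableSet_Iic fun u hu => ?_
      simp only [logConvDensity]
      rw [tsum_eq_sum (s := Finset.range K) fun n hn => by rw [hz n hn u hu, zero_div],
        Finset.mul_sum]
    · intro n _
      exact (((integrable_convPowSucc hi n).div_const _).const_mul _).restrict
  rw [h2]
  refine hasSum_sum_of_ne_finset_zero fun n hn => ?_
  rw [setIntegral_congr_fun measurableSet_Iic (hz n hn)]
  simp

theorem halfCdf_eq (hκ : 0 < κ) (h0 : ∀ x < κ, d x = 0) (hi : Integrable d) (θ : ℝ) :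
    halfCdf d θ = (1 / 2) * ∫ u in Set.Iic θ, d u := by
  have h2 : ∫ u in Set.Iic (0 : ℝ), d u = 0 := by
    rw [setIntegral_congr_fun measurableSet_Iic fun u hu => h0 u (lt_of_le_of_lt hu hκ)]
    simp
  rw [halfCdf, ← intervalIntegral.integral_Iic_sub_Iic hi.integrableOn hi.integrableOn, h2,
    sub_zero]

theorem convWithPow_halfCdf (hκ : 0 < κ) (h0 : ∀ x < κ, d x = 0) (hi : Integrable d) (n : ℕ)
    (θ : ℝ) : convWithPow (halfCdf d) d n θ = (1 / 2) * ∫ u in Set.Iic θ, convPowSucc d n u := by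
  cases n with
  | zero => exact halfCdf_eq hκ h0 hi θ
  | succ n =>
    simp only [convWithPow, convPowSucc]
    rw [setIntegral_Iic_realConv (integrable_convPowSucc hi n) hi, realConv_apply,
      ← integral_sub_left_eq_self _ volume θ, ← integral_const_mul]
    congr 1
    ext t
    rw [halfCdf_eq hκ h0 hi]
    simp
    ring

theorem continuousAt_density (h0 : ∀ x, x ∉ Set.Icc κ lam → d x = 0)
    (hc : ContinuousOn d (Set.Ioo κ lam)) {x : ℝ} (hx : x ∉ ({κ, lam} : Set ℝ)) :
    ContinuousAt d x := by
  by_cases h : x ∈ Set.Icc κ lam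
  · have h' : x ∈ Set.Ioo κ lam :=
      ⟨lt_of_le_of_ne h.1 fun e => hx (by simp [e]), lt_of_le_of_ne h.2 fun e => hx (by simp [e])⟩
    exact hc.continuousAt (isOpen_Ioo.mem_nhds h')
  · refine (continuousAt_const (y := (0 : ℝ))).congr ?_
    filter_upwards [isClosed_Icc.isOpen_compl.mem_nhds h] with y hy
    exact (h0 y hy).symm

/-- Near `θ` the series is a finite sum. Convolution powers from the second on are continuous
everywhere; `d` itself may jump at `lam`, but is zero beyond it. -/
theorem continuousAt_logConvDensity (hκ : 0 < κ) (hi : Integrable d)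
    (h0 : ∀ x, x ∉ Set.Icc κ lam → d x = 0) (hc : ContinuousOn d (Set.Ioo κ lam))
    {M : ℝ} (hM : ∀ x, |d x| ≤ M) {θ : ℝ} (hθ : lam < θ) :
    ContinuousAt (logConvDensity d) θ := by
  have h0' : ∀ x < κ, d x = 0 := fun x hx => h0 x fun h => absurd h.1 (not_le.2 hx)
  have hcn : ∀ n, ContinuousAt (convPowSucc d n) θ := by
    intro n
    cases n with
    | zero =>
      refine (continuousAt_const (y := (0 : ℝ))).congr ?_
      filter_upwards [isOpen_Ioi.mem_nhds hθ] with y hy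
      exact (h0 y fun h => absurd h.2 (not_le.2 hy)).symm
    | succ n =>
      exact (continuous_realConv (integrable_convPowSucc hi n) hi.aestronglyMeasurable hM
        (Set.toFinite {κ, lam}).countable fun x hx => continuousAt_density h0 hc hx).continuousAt
  obtain ⟨K, hK⟩ := exists_nat_gt (θ / κ)
  rw [div_lt_iff₀ hκ] at hK
  have hcs : ContinuousAt (fun u => (1 / 2) * ∑ n ∈ Finset.range K,
      convPowSucc d n u / ((n : ℝ) + 1)) θ := by
    refine continuousAt_const.mul (tendsto_finsetSum _ fun n _ => ?_)
    exact (hcn n).div_const _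
  refine hcs.congr ?_
  filter_upwards [isOpen_Iio.mem_nhds hK] with u hu
  rw [logConvDensity, tsum_eq_sum]
  intro n hn
  have : (K : ℝ) ≤ n := by exact_mod_cast not_lt.1 fun h => hn (Finset.mem_range.2 h)
  have hu' : u < K * κ := hu
  rw [convPowSucc_eq_zero h0' n _ (by nlinarith), zero_div]

/-- If `d x > 2C`, then by continuity `½ d`, hence the larger logarithmic density, has mean above
`C` on a short interval to the right of `x`. -/
theorem le_of_integral_logConvDensity_le (hκ : 0 < κ) (h0 : ∀ x < κ, d x = 0)
    (hd : ∀ x, 0 ≤ d x) (hi : Integrable d) (h1 : ∫ x, d x = 1)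
    (hc : ContinuousOn d (Set.Ioo κ lam)) {C : ℝ}
    (hC : ∀ a b, κ ≤ a → a ≤ b → ∫ u in a..b, logConvDensity d u ≤ C * (b - a)) {x : ℝ}
    (hx : x ∈ Set.Ioo κ lam) : d x ≤ 2 * C := by
  by_contra! hlt
  obtain ⟨m, hm1, hm2⟩ := exists_between hlt
  have hev := (hc.continuousAt (isOpen_Ioo.mem_nhds hx)).eventually_const_lt hm2
  obtain ⟨ε, hε, hball⟩ := Metric.eventually_nhds_iff.1 hev
  have hle : x ≤ x + ε / 2 := by linarith
  have h2 := hC x (x + ε / 2) hx.1.le hle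
  have h3 : ∫ u in x..(x + ε / 2), m / 2 ≤ ∫ u in x..(x + ε / 2), logConvDensity d u := by
    refine intervalIntegral.integral_mono_on hle intervalIntegrable_const ?_ fun u hu => ?_
    · rw [intervalIntegrable_iff_integrableOn_Ioc_of_le hle]
      exact (integrableOn_logConvDensity hκ h0 hd hi h1 _).mono_set Set.Ioc_subset_Iic_self
    · have : m < d u := hball (by
        rw [Real.dist_eq, abs_lt]; constructor <;> linarith [hu.1, hu.2])
      linarith [half_le_logConvDensity hκ h0 hd u]
  rw [intervalIntegral.integral_const, smul_eq_mul] at h3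
  nlinarith

end

/-! ### Euler products: `log ζ - log L` as a sum over prime nonresidues. -/

theorem exp_tsum_primes_neg_log {f : ℕ →*₀ ℝ} {w : ℝ} (hw : 1 < w)
    (hf : ∀ n : ℕ, |f n| ≤ (n : ℝ) ^ (-w)) :
    (Summable fun q : Nat.Primes => Real.log (1 - f q)) ∧
      0 < ∑' n, f n ∧ Real.log (∑' n, f n) = -∑' q : Nat.Primes, Real.log (1 - f q) := by
  have hs : Summable fun n => ‖f n‖ :=
    Summable.of_nonneg_of_le (fun n => norm_nonneg _) hf (Real.summable_nat_rpow.2 (by linarith))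
  have hlog : Summable fun q : Nat.Primes => Real.log (1 - f q) := by
    simp only [sub_eq_add_neg]
    refine Real.summable_log_one_add_of_summable (f := fun q : Nat.Primes => -f q) ?_
    exact (hs.of_norm.comp_injective Nat.Primes.coe_nat_injective).neg
  have hpos : ∀ q : Nat.Primes, 0 < 1 - f q := by
    intro q
    have h1 : ((q : ℕ) : ℝ) ^ (-w) < 1 :=
      Real.rpow_lt_one_of_one_lt_of_neg (by exact_mod_cast q.2.one_lt) (by linarith)
    linarith [(le_abs_self _).trans (hf q)]
  have h1 := Real.rexp_tsum_eq_tprod (f := fun q : Nat.Primes => (1 - f q)⁻¹)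
    (fun q => inv_pos.2 (hpos q)) (by simpa only [Real.log_inv] using hlog.neg)
  rw [EulerProduct.eulerProduct_completely_multiplicative_tprod hs] at h1
  simp only [Real.log_inv, tsum_neg] at h1
  refine ⟨hlog, h1 ▸ Real.exp_pos _, ?_⟩
  rw [← h1, Real.log_exp]

/-- `n ↦ n ^ (-w)` as a completely multiplicative function. -/
noncomputable def natRpowHom (w : ℝ) (hw : w ≠ 0) : ℕ →*₀ ℝ where
  toFun n := (n : ℝ) ^ (-w)
  map_zero' := by simp [Real.zero_rpow, hw]
  map_one' := by simp
  map_mul' m n := by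
    push_cast
    exact Real.mul_rpow m.cast_nonneg n.cast_nonneg

open Classical in
/-- The quadratic character modulo `p` with real values. -/
noncomputable def realLegendre (p n : ℕ) : ℝ :=
  if IsNonresidueMod p n then -1 else if p ∣ n then 0 else 1

theorem realLegendre_eq {p : ℕ} [hp : Fact p.Prime] (n : ℕ) :
    realLegendre p n = legendreSym p n := by
  have h0 : legendreSym p n = 0 ↔ p ∣ n := by
    rw [legendreSym.eq_zero_iff, Int.cast_natCast, ZMod.natCast_eq_zero_iff]
  have h1 : IsNonresidueMod p n ↔ legendreSym p n = -1 := ⟨fun ⟨_, h⟩ => h, fun h => ⟨hp.out, h⟩⟩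
  rw [realLegendre]
  simp only [h1, ← h0]
  split_ifs with h2 h3
  · simp [h2]
  · simp [h3]
  · have := legendreSym.eq_one_or_neg_one p (a := n) fun h => h3 ((legendreSym.eq_zero_iff p n).2 h)
    simp [this.resolve_right h2]

theorem exists_realLegendre_hom {p : ℕ} (hp : p.Prime) :
    ∃ f : ℕ →*₀ ℝ, ∀ n, f n = realLegendre p n := by
  have := Fact.mk hp
  refine ⟨⟨⟨realLegendre p, ?_⟩, ?_, ?_⟩, fun n => rfl⟩
  · simp [realLegendre_eq]
  · simp [realLegendre_eq]
  · intro m n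
    simp [realLegendre_eq, legendreSym.mul]

theorem abs_realLegendre_le (p n : ℕ) : |realLegendre p n| ≤ 1 := by
  rw [realLegendre]; split_ifs <;> simp

theorem not_dvd_of_isNonresidueMod {p n : ℕ} (h : IsNonresidueMod p n) : ¬ p ∣ n := by
  obtain ⟨hp, h⟩ := h
  have := Fact.mk hp
  intro hd
  have : legendreSym p n = 0 := by
    rw [legendreSym.eq_zero_iff, Int.cast_natCast, ZMod.natCast_eq_zero_iff]; exact hd
  omega

theorem abs_log_diff_le {x : ℝ} (h0 : 0 ≤ x) (h1 : x ≤ 1 / 2) :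
    |Real.log (1 + x) - Real.log (1 - x) - 2 * x| ≤ 2 * x ^ 2 := by
  have a1 := Real.log_le_sub_one_of_pos (show 0 < 1 + x by linarith)
  have a2 := Real.log_le_sub_one_of_pos (show 0 < 1 - x by linarith)
  have a3 := Real.one_sub_inv_le_log_of_pos (show 0 < 1 + x by linarith)
  have a4 := Real.one_sub_inv_le_log_of_pos (show 0 < 1 - x by linarith)
  have b1 : (1 + x)⁻¹ ≤ 1 - x + x ^ 2 := by
    rw [inv_le_iff_one_le_mul₀ (by linarith)]; nlinarith [pow_nonneg h0 3]
  have b2 : (1 - x)⁻¹ ≤ 1 + x + 2 * x ^ 2 := by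
    rw [inv_le_iff_one_le_mul₀ (by linarith)]; nlinarith [mul_nonneg (sq_nonneg x) (by linarith : 0 ≤ 1 - 2 * x)]
  rw [abs_le]; constructor <;> nlinarith [sq_nonneg x]

theorem abs_log_one_sub_le {x : ℝ} (h0 : 0 ≤ x) (h1 : x ≤ 1 / 2) :
    |Real.log (1 - x)| ≤ 2 * x := by
  have a2 := Real.log_le_sub_one_of_pos (show 0 < 1 - x by linarith)
  have a4 := Real.one_sub_inv_le_log_of_pos (show 0 < 1 - x by linarith)
  have b2 : (1 - x)⁻¹ ≤ 1 + 2 * x := by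
    rw [inv_le_iff_one_le_mul₀ (by linarith)]; nlinarith
  rw [abs_le]; constructor <;> linarith

/-- `1 / q` if `q` is a prime nonresidue modulo `p`, and `0` otherwise. -/
noncomputable def nonresiduePrimeWeight (p q : ℕ) : ℝ :=
  open Classical in if q.Prime ∧ IsNonresidueMod p q then (q : ℝ)⁻¹ else 0

theorem nonresiduePrimeWeight_nonneg (p q : ℕ) : 0 ≤ nonresiduePrimeWeight p q := by
  rw [nonresiduePrimeWeight]; split_ifs <;> positivity

theorem nonresiduePrimeWeight_le (p q : ℕ) : nonresiduePrimeWeight p q ≤ (q : ℝ)⁻¹ := by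
  rw [nonresiduePrimeWeight]; split_ifs
  exacts [le_rfl, by positivity]

theorem summable_weight_mul_rpow (p : ℕ) {w : ℝ} (hw : 1 < w) :
    Summable fun q : ℕ => nonresiduePrimeWeight p q * (q : ℝ) ^ (1 - w) := by
  refine Summable.of_nonneg_of_le
    (fun q => mul_nonneg (nonresiduePrimeWeight_nonneg p q) (by positivity)) (fun q => ?_)
    (Real.summable_nat_rpow.2 (show -w < -1 by linarith))
  rcases Nat.eq_zero_or_pos q with rfl | hq
  · simpa [nonresiduePrimeWeight, Nat.not_prime_zero] using Real.rpow_nonneg le_rfl _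
  · have hq' : (0 : ℝ) < q := by exact_mod_cast hq
    have : (q : ℝ) ^ (-w) = (q : ℝ)⁻¹ * (q : ℝ) ^ (1 - w) := by
      rw [← Real.rpow_neg_one, ← Real.rpow_add hq']; ring_nf
    rw [this]
    exact mul_le_mul_of_nonneg_right (nonresiduePrimeWeight_le p q) (by positivity)

open Classical in
-- With `x = q^(-w)`: residues cancel, a nonresidue gives `log ((1 + x) / (1 - x)) = 2x + O(x²)`,
-- and `q = p` leaves only the zeta factor, at most `2/p`. The bounds do not depend on `w`, so `w`
-- may tend to `1` with `p`.
theorem abs_euler_factor_diff_le {p : ℕ} (hp : p.Prime) {w : ℝ} (hw : 1 < w) {B : ℝ}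
    (hB : ∀ q : ℕ, IsNonresidueMod p q → B ≤ q) {q : ℕ} (hq : q.Prime) :
    |Real.log (1 - realLegendre p q * (q : ℝ) ^ (-w)) - Real.log (1 - (q : ℝ) ^ (-w)) -
      2 * (nonresiduePrimeWeight p q * (q : ℝ) ^ (1 - w))| ≤
      (if B ≤ (q : ℝ) then 2 * (q : ℝ) ^ (-2 : ℝ) else 0) + if q = p then 2 / (p : ℝ) else 0 := by
  have hq2 : (2 : ℝ) ≤ q := by exact_mod_cast hq.two_le
  have hq0 : (0 : ℝ) < q := by linarith
  have hx0 : 0 ≤ (q : ℝ) ^ (-w) := by positivity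
  have hx : (q : ℝ) ^ (-w) ≤ (q : ℝ)⁻¹ := by
    rw [← Real.rpow_neg_one]
    exact Real.rpow_le_rpow_of_exponent_le (by linarith) (by linarith)
  have hx2 : (q : ℝ) ^ (-w) ≤ 1 / 2 := hx.trans (by
    rw [one_div]; exact inv_anti₀ (by norm_num) hq2)
  by_cases hN : IsNonresidueMod p q
  · have e1 : (q : ℝ) ^ (-w) = (q : ℝ)⁻¹ * (q : ℝ) ^ (1 - w) := by
      rw [← Real.rpow_neg_one, ← Real.rpow_add hq0]; ring_nf
    have e2 : nonresiduePrimeWeight p q * (q : ℝ) ^ (1 - w) = (q : ℝ) ^ (-w) := by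
      rw [nonresiduePrimeWeight, if_pos ⟨hq, hN⟩, e1]
    have e3 : realLegendre p q = -1 := if_pos hN
    have e4 : q ≠ p := fun h => not_dvd_of_isNonresidueMod hN (h ▸ dvd_rfl)
    simp only [e2, e3, if_pos (hB q hN), if_neg e4, add_zero]
    have := abs_log_diff_le hx0 hx2
    rw [neg_one_mul, sub_neg_eq_add]
    refine this.trans ?_
    have e5 : (q : ℝ) ^ (-2 : ℝ) = ((q : ℝ)⁻¹) ^ 2 := by
      rw [Real.rpow_neg hq0.le, inv_pow]; norm_num
    rw [e5]
    exact mul_le_mul_of_nonneg_left (pow_le_pow_left₀ hx0 hx 2) (by norm_num)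
  · have e2 : nonresiduePrimeWeight p q = 0 := if_neg fun h => hN h.2
    by_cases hqp : q = p
    · subst hqp
      have e3 : realLegendre q q = 0 := by simp [realLegendre, hN]
      simp only [e2, e3, if_true]
      rw [zero_mul, sub_zero, Real.log_one, zero_sub, zero_mul, mul_zero, sub_zero, abs_neg]
      refine (abs_log_one_sub_le hx0 hx2).trans ?_
      have : (0 : ℝ) ≤ if B ≤ (q : ℝ) then 2 * (q : ℝ) ^ (-2 : ℝ) else 0 := by
        split_ifs <;> positivity
      rw [div_eq_mul_inv]
      linarith
    · have e3 : realLegendre p q = 1 := by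
        have : ¬ p ∣ q := fun h => hqp ((Nat.prime_dvd_prime_iff_eq hp hq).1 h).symm
        simp [realLegendre, hN, this]
      simp only [e2, e3, one_mul, sub_self, zero_mul, mul_zero, abs_zero]
      have : (0 : ℝ) ≤ 2 / p := by positivity
      split_ifs <;> positivity

open Classical in
theorem abs_log_zeta_sub_log_L_le {p : ℕ} (hp : p.Prime) {w : ℝ} (hw : 1 < w) {B : ℝ}
    (hB : ∀ q : ℕ, IsNonresidueMod p q → B ≤ q) :
    0 < ∑' n : ℕ, realLegendre p n * (n : ℝ) ^ (-w) ∧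
    |Real.log (∑' n : ℕ, (n : ℝ) ^ (-w)) - Real.log (∑' n : ℕ, realLegendre p n * (n : ℝ) ^ (-w)) -
      2 * ∑' q : ℕ, nonresiduePrimeWeight p q * (q : ℝ) ^ (1 - w)| ≤
      (∑' q : ℕ, if B ≤ (q : ℝ) then 2 * (q : ℝ) ^ (-2 : ℝ) else 0) + 2 / p := by
  obtain ⟨f, hf⟩ := exists_realLegendre_hom hp
  have hw0 : w ≠ 0 := by linarith
  have hz := exp_tsum_primes_neg_log (f := natRpowHom w hw0) hw fun n => by
    change |(n : ℝ) ^ (-w)| ≤ _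
    rw [abs_of_nonneg (by positivity)]
  have hl := exp_tsum_primes_neg_log (f := f * natRpowHom w hw0) hw fun n => by
    change |f n * (n : ℝ) ^ (-w)| ≤ _
    rw [abs_mul, abs_of_nonneg (a := (n : ℝ) ^ (-w)) (by positivity), hf]
    exact mul_le_of_le_one_left (by positivity) (abs_realLegendre_le p n)
  have ez : ∀ n, natRpowHom w hw0 n = (n : ℝ) ^ (-w) := fun n => rfl
  have el : ∀ n, (f * natRpowHom w hw0) n = realLegendre p n * (n : ℝ) ^ (-w) := fun n => by
    rw [← hf]; rfl
  simp only [ez] at hz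
  simp only [el] at hl
  refine ⟨hl.2.1, ?_⟩
  rw [hz.2.2, hl.2.2]
  have hsw := summable_weight_mul_rpow p hw
  have hsB : Summable fun q : ℕ => if B ≤ (q : ℝ) then 2 * (q : ℝ) ^ (-2 : ℝ) else 0 := by
    refine Summable.of_nonneg_of_le (fun q => by split_ifs <;> positivity) (fun q => ?_)
      ((Real.summable_nat_rpow.2 (show (-2 : ℝ) < -1 by norm_num)).mul_left 2)
    split_ifs
    exacts [le_rfl, by positivity]
  have hcoe : (∑' q : ℕ, nonresiduePrimeWeight p q * (q : ℝ) ^ (1 - w)) =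
      ∑' q : Nat.Primes, nonresiduePrimeWeight p q * ((q : ℕ) : ℝ) ^ (1 - w) := by
    refine (tsum_subtype_eq_of_support_subset (s := {q : ℕ | q.Prime}) fun q hq => ?_).symm
    by_contra h
    exact hq (by simp [nonresiduePrimeWeight, show ¬ q.Prime from h])
  have hsw' : Summable fun q : Nat.Primes =>
      nonresiduePrimeWeight p q * ((q : ℕ) : ℝ) ^ (1 - w) := hsw.comp_injective Nat.Primes.coe_nat_injective
  have hsB' : Summable fun q : ℕ => (if B ≤ (q : ℝ) then 2 * (q : ℝ) ^ (-2 : ℝ) else 0) +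
      if q = p then 2 / (p : ℝ) else 0 := hsB.add (hasSum_ite_eq p _).summable
  have hbt : (∑' q : ℕ, if B ≤ (q : ℝ) then 2 * (q : ℝ) ^ (-2 : ℝ) else 0) + 2 / (p : ℝ) =
      ∑' q : ℕ, ((if B ≤ (q : ℝ) then 2 * (q : ℝ) ^ (-2 : ℝ) else 0) +
        if q = p then 2 / (p : ℝ) else 0) := by
    rw [hsB.tsum_add (hasSum_ite_eq p _).summable, tsum_ite_eq]
  rw [hcoe, hbt, ← tsum_mul_left, neg_sub_neg, ← hl.1.tsum_sub hz.1,
    ← (hl.1.sub hz.1).tsum_sub (hsw'.mul_left 2)]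
  refine (norm_tsum_le_tsum_norm ((hl.1.sub hz.1).sub (hsw'.mul_left 2)).norm).trans ?_
  refine le_trans ?_ (Summable.tsum_subtype_le _ {q : ℕ | q.Prime} (fun q => ?_) hsB')
  · refine Summable.tsum_le_tsum (fun q => ?_) ((hl.1.sub hz.1).sub (hsw'.mul_left 2)).norm
      (hsB'.comp_injective Nat.Primes.coe_nat_injective)
    exact abs_euler_factor_diff_le hp hw hB q.2
  · have : (0 : ℝ) ≤ 2 / p := by positivity
    split_ifs <;> positivity

/-! ### Partial summation and the limit of the L-function near 1. -/

/-- Write `n^(-(1 + s/L))` as `(L + s)` times the integral of `exp (-((L + s) u))` over `u ≥ log n /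
L` and interchange. With `L = log p` the variable `u` is the exponent `θ` of the counting
hypothesis. -/
theorem tsum_mul_rpow_eq_integral {a : ℕ → ℝ} (ha : ∀ n, |a n| ≤ 1) {L s : ℝ} (hL : 0 < L)
    (hs : 0 < s) :
    ∑' n : ℕ, a n * (n : ℝ) ^ (-(1 + s / L)) =
      (L + s) * ∫ u, (∑ n ∈ Finset.Icc 1 ⌊Real.exp (L * u)⌋₊, a n) * Real.exp (-((L + s) * u)) := by
  have hLs : 0 < L + s := by linarith
  -- The term `n = 0` must be removed by hand: `Real.log 0 = 0` would give it a nonzero integral.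
  set b : ℕ → ℝ := fun n => if n = 0 then 0 else a n with hb
  have hb1 : ∀ n, |b n| ≤ 1 := fun n => by
    simp only [hb]; split_ifs
    · simp
    · exact ha n
  have hw0 : -(1 + s / L) ≠ 0 := by
    have : 0 < s / L := by positivity
    linarith
  set G : ℕ → ℝ → ℝ := fun n => (Set.Ici (Real.log n / L)).indicator
    fun u => b n * Real.exp (-((L + s) * u)) with hG
  have hexp : ∀ c : ℝ, IntegrableOn (fun u => Real.exp (-((L + s) * u))) (Set.Ici c) := fun c => by
    rw [integrableOn_Ici_iff_integrableOn_Ioi]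
    simpa only [neg_mul] using integrableOn_exp_mul_Ioi (neg_lt_zero.2 hLs) c
  have hexpI : ∀ c : ℝ, ∫ u in Set.Ici c, Real.exp (-((L + s) * u)) =
      Real.exp (-((L + s) * c)) / (L + s) := fun c => by
    rw [integral_Ici_eq_integral_Ioi]
    have := integral_exp_mul_Ioi (neg_lt_zero.2 hLs) c
    simp only [neg_mul] at this
    rw [this, neg_div_neg_eq]
  have hGi : ∀ n, Integrable (G n) := fun n =>
    (integrable_indicator_iff measurableSet_Ici).2 ((hexp _).const_mul _)
  have hpow : ∀ n : ℕ, n ≠ 0 →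
      Real.exp (-((L + s) * (Real.log n / L))) = (n : ℝ) ^ (-(1 + s / L)) := fun n hn => by
    rw [Real.rpow_def_of_pos (by positivity)]
    congr 1
    field_simp
  have hGI : ∀ n, ∫ u, G n u = (a n * (n : ℝ) ^ (-(1 + s / L))) / (L + s) := fun n => by
    simp only [hG]
    rw [integral_indicator measurableSet_Ici, integral_const_mul, hexpI]
    rcases eq_or_ne n 0 with rfl | hn
    · rw [Nat.cast_zero, Real.zero_rpow hw0]
      simp [hb]
    · rw [hpow n hn]
      simp only [hb, if_neg hn]
      ring
  have hGn : ∀ n, ∫ u, ‖G n u‖ ≤ (n : ℝ) ^ (-(1 + s / L)) / (L + s) := fun n => by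
    rcases eq_or_ne n 0 with rfl | hn
    · rw [Nat.cast_zero, Real.zero_rpow hw0]
      simp [hG, hb]
    · simp only [hG, norm_indicator_eq_indicator_norm, norm_mul, Real.norm_eq_abs, Real.abs_exp]
      rw [integral_indicator measurableSet_Ici, integral_const_mul, hexpI, hpow n hn]
      exact mul_le_of_le_one_left (by positivity) (hb1 n)
  have hsum : Summable fun n => ∫ u, ‖G n u‖ :=
    Summable.of_nonneg_of_le (fun n => integral_nonneg fun u => norm_nonneg _) hGn
      ((Real.summable_nat_rpow.2 (by
        have : 0 < s / L := by positivity
        linarith)).div_const _)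
  have hpt : ∀ u, ∑' n, G n u =
      (∑ n ∈ Finset.Icc 1 ⌊Real.exp (L * u)⌋₊, a n) * Real.exp (-((L + s) * u)) := fun u => by
    have hmem : ∀ n : ℕ, n ≠ 0 → (Real.log n / L ≤ u ↔ n ∈ Finset.Icc 1 ⌊Real.exp (L * u)⌋₊) := by
      intro n hn
      rw [Finset.mem_Icc, Nat.le_floor_iff (Real.exp_pos _).le, div_le_iff₀ hL,
        Real.log_le_iff_le_exp (by positivity), mul_comm u]
      exact ⟨fun h => ⟨Nat.one_le_iff_ne_zero.2 hn, h⟩, fun h => h.2⟩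
    rw [tsum_eq_sum (s := Finset.Icc 1 ⌊Real.exp (L * u)⌋₊), Finset.sum_mul]
    · refine Finset.sum_congr rfl fun n hn => ?_
      have hn0 : n ≠ 0 := Nat.one_le_iff_ne_zero.1 (Finset.mem_Icc.1 hn).1
      simp only [hG]
      rw [Set.indicator_of_mem (show u ∈ Set.Ici (Real.log n / L) from (hmem n hn0).2 hn)]
      simp only [hb, if_neg hn0]
    · intro n hn
      rcases eq_or_ne n 0 with rfl | hn0
      · simp [hG, hb]
      · exact Set.indicator_of_notMem (fun h => hn ((hmem n hn0).1 h)) _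
  have := hasSum_integral_of_summable_integral_norm hGi hsum
  simp only [hpt, hGI] at this
  rw [← this.tsum_eq, tsum_div_const]
  field_simp

theorem card_dvd_le (p N : ℕ) : ((Finset.Icc 1 N).filter (p ∣ ·)).card ≤ N / p := by
  rw [← Nat.Ioc_filter_dvd_card_eq_div]
  rfl

open Classical in
theorem sum_realLegendre (p : ℕ) (X : ℝ) :
    ∑ n ∈ Finset.Icc 1 ⌊X⌋₊, realLegendre p n =
      (⌊X⌋₊ : ℝ) - ((Finset.Icc 1 ⌊X⌋₊).filter (p ∣ ·)).card - 2 * (nonresiduesUpTo p X).card := by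
  have : ∀ n, realLegendre p n =
      1 - (if p ∣ n then (1 : ℝ) else 0) - 2 * (if IsNonresidueMod p n then (1 : ℝ) else 0) := by
    intro n
    rw [realLegendre]
    split_ifs with h1 h2
    · exact absurd h2 (not_dvd_of_isNonresidueMod h1)
    all_goals norm_num
  simp only [this, Finset.sum_sub_distrib, ← Finset.mul_sum, Finset.sum_boole, nonresiduesUpTo]
  simp

theorem tendsto_mean_realLegendre {P : Set ℕ} {θ y : ℝ} (hθ : 0 < θ)
    (hN : Tendsto (fun p : ℕ => ((nonresiduesUpTo p ((p : ℝ) ^ θ)).card : ℝ) / (p : ℝ) ^ θ)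
        (atTop ⊓ 𝓟 P) (𝓝 y)) :
    Tendsto (fun p : ℕ => (∑ n ∈ Finset.Icc 1 ⌊(p : ℝ) ^ θ⌋₊, realLegendre p n) / (p : ℝ) ^ θ)
      (atTop ⊓ 𝓟 P) (𝓝 (1 - 2 * y)) := by
  have hnat : Tendsto (fun p : ℕ => (p : ℝ)) (atTop ⊓ 𝓟 P) atTop :=
    tendsto_natCast_atTop_atTop.mono_left inf_le_left
  have hX := (tendsto_rpow_atTop hθ).comp hnat
  have h1 := (tendsto_nat_floor_div_atTop (R := ℝ)).comp hX
  have h2 : Tendsto (fun p : ℕ =>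
      (((Finset.Icc 1 ⌊(p : ℝ) ^ θ⌋₊).filter (p ∣ ·)).card : ℝ) / (p : ℝ) ^ θ)
      (atTop ⊓ 𝓟 P) (𝓝 0) := by
    refine squeeze_zero' (Eventually.of_forall fun p => by positivity) ?_ hnat.inv_tendsto_atTop
    filter_upwards [hX.eventually_gt_atTop 0] with p hp
    have hp : 0 < (p : ℝ) ^ θ := hp
    rw [div_le_iff₀ hp]
    refine (Nat.cast_le.2 (card_dvd_le p _)).trans (Nat.cast_div_le.trans ?_)
    rw [div_eq_inv_mul, Pi.inv_apply]
    exact mul_le_mul_of_nonneg_left (Nat.floor_le hp.le) (by positivity)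
  have := (h1.sub h2).sub (hN.const_mul 2)
  rw [sub_zero] at this
  refine this.congr fun p => ?_
  simp only [Function.comp, sum_realLegendre]
  ring

theorem integral_exp_mul_one_sub_cdf {d : ℝ → ℝ} {κ : ℝ} (hκ : 0 < κ) (h0 : ∀ x < κ, d x = 0)
    (hi : Integrable d) {s : ℝ} (hs : 0 < s) :
    s * ∫ u in Set.Ici (0 : ℝ), (1 - 2 * halfCdf d u) * Real.exp (-(s * u)) =
      1 - laplaceReal d s := by
  -- Integration by parts in the form of a convolution: the tilted `d` against the tilted Heaviside
  -- function is `2δ(u) exp (-su)`.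
  set E : ℝ → ℝ := (Set.Ici (0 : ℝ)).indicator fun u => Real.exp (-(s * u)) with hE
  have hEi : IntegrableOn (fun u => Real.exp (-(s * u))) (Set.Ici (0 : ℝ)) := by
    rw [integrableOn_Ici_iff_integrableOn_Ioi]
    simpa only [neg_mul] using integrableOn_exp_mul_Ioi (neg_lt_zero.2 hs) 0
  have hEI : ∫ u in Set.Ici (0 : ℝ), Real.exp (-(s * u)) = 1 / s := by
    rw [integral_Ici_eq_integral_Ioi]
    have := integral_exp_mul_Ioi (neg_lt_zero.2 hs) 0
    simp only [neg_mul] at this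
    simp [this]
  have hEi' : Integrable E := (integrable_indicator_iff measurableSet_Ici).2 hEi
  have hde := integrable_mul_exp hκ h0 hi hs.le
  have hconv : ∀ u, realConv (fun u => d u * Real.exp (-(s * u))) E u =
      2 * halfCdf d u * Real.exp (-(s * u)) := by
    intro u
    rw [halfCdf_eq hκ h0 hi, realConv_apply, ← integral_indicator measurableSet_Iic,
      ← mul_assoc, ← integral_const_mul, ← integral_mul_const]
    congr 1
    ext t
    by_cases h : t ≤ u
    · simp only [hE]
      rw [Set.indicator_of_mem (show u - t ∈ Set.Ici (0 : ℝ) by simpa using h),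
        Set.indicator_of_mem (show t ∈ Set.Iic u from h), mul_assoc, ← Real.exp_add]
      ring_nf
    · simp only [hE]
      rw [Set.indicator_of_notMem (show u - t ∉ Set.Ici (0 : ℝ) by simpa using h),
        Set.indicator_of_notMem (show t ∉ Set.Iic u from h)]
      simp
  have hzero : ∀ u < 0, halfCdf d u = 0 := by
    intro u hu
    rw [halfCdf_eq hκ h0 hi, setIntegral_congr_fun measurableSet_Iic
      fun t ht => h0 t ((lt_of_le_of_lt ht hu).trans hκ)]
    simp
  have hci := integrable_realConv hde hEi'
  have hcI := integral_realConv hde hEi'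
  rw [hE, integral_indicator measurableSet_Ici, hEI, ← hE] at hcI
  have hsplit : ∫ u in Set.Ici (0 : ℝ), 2 * halfCdf d u * Real.exp (-(s * u)) =
      laplaceReal d s * (1 / s) := by
    rw [laplaceReal, ← hcI, ← integral_indicator measurableSet_Ici]
    congr 1
    ext u
    rw [hconv]
    by_cases h : 0 ≤ u
    · rw [Set.indicator_of_mem (Set.mem_Ici.2 h)]
    · rw [Set.indicator_of_notMem (by simpa using h), hzero u (not_le.1 h)]
      simp
  have hci' : IntegrableOn (fun u => 2 * halfCdf d u * Real.exp (-(s * u))) (Set.Ici (0 : ℝ)) :=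
    (hci.congr (Eventually.of_forall hconv)).integrableOn
  simp only [sub_mul, one_mul]
  rw [integral_sub hEi hci', hsplit, hEI]
  field_simp

/-- Dominated convergence in the integral representation: the trivial bound `|∑ χ(n)| ≤ X` gives the
majorant `exp (-su)`, and the mean of `χ` up to `p^u` tends to `1 - 2δ(u)` for `u > 0`. -/
theorem tendsto_L_div_log {P : Set ℕ} {d : ℝ → ℝ} {κ : ℝ} (hκ : 0 < κ) (h0 : ∀ x < κ, d x = 0)
    (hi : Integrable d)
    (hN : ∀ θ : ℝ, 0 ≤ θ →
      Tendsto (fun p : ℕ => ((nonresiduesUpTo p ((p : ℝ) ^ θ)).card : ℝ) / (p : ℝ) ^ θ)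
        (atTop ⊓ 𝓟 P) (𝓝 (halfCdf d θ))) {s : ℝ} (hs : 0 < s) :
    Tendsto (fun p : ℕ => s / Real.log p *
        ∑' n : ℕ, realLegendre p n * (n : ℝ) ^ (-(1 + s / Real.log p)))
      (atTop ⊓ 𝓟 P) (𝓝 (1 - laplaceReal d s)) := by
  have hlog : Tendsto (fun p : ℕ => Real.log p) (atTop ⊓ 𝓟 P) atTop :=
    Real.tendsto_log_atTop.comp (tendsto_natCast_atTop_atTop.mono_left inf_le_left)
  have hpos : ∀ᶠ p : ℕ in atTop ⊓ 𝓟 P, 1 < (p : ℝ) :=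
    (tendsto_natCast_atTop_atTop.mono_left inf_le_left).eventually_gt_atTop 1
  have key : Tendsto (fun p : ℕ => ∫ u, (∑ n ∈ Finset.Icc 1 ⌊Real.exp (Real.log p * u)⌋₊,
      realLegendre p n) * Real.exp (-((Real.log p + s) * u))) (atTop ⊓ 𝓟 P)
      (𝓝 (∫ u, (Set.Ici (0 : ℝ)).indicator
        (fun u => (1 - 2 * halfCdf d u) * Real.exp (-(s * u))) u)) := by
    refine tendsto_integral_filter_of_dominated_convergence
      ((Set.Ici (0 : ℝ)).indicator fun u => Real.exp (-(s * u))) ?_ ?_ ?_ ?_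
    · refine Eventually.of_forall fun p => Measurable.aestronglyMeasurable ?_
      refine Measurable.mul ?_ (by fun_prop)
      exact (measurable_from_nat (f := fun N => ∑ n ∈ Finset.Icc 1 N, realLegendre p n)).comp
        (Nat.measurable_floor.comp (by fun_prop))
    · filter_upwards [hpos] with p hp
      have hl : 0 < Real.log p := Real.log_pos hp
      refine Eventually.of_forall fun u => ?_
      by_cases h : 0 ≤ u
      · rw [Set.indicator_of_mem (Set.mem_Ici.2 h), norm_mul, Real.norm_eq_abs, Real.norm_eq_abs,
          Real.abs_exp, show -((Real.log p + s) * u) = -(Real.log p * u) + -(s * u) by ring,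
          Real.exp_add, ← mul_assoc]
        refine mul_le_of_le_one_left (Real.exp_pos _).le ?_
        rw [Real.exp_neg, ← div_eq_mul_inv, div_le_one (Real.exp_pos _)]
        refine (Finset.abs_sum_le_sum_abs _ _).trans
          ((Finset.sum_le_sum fun n _ => abs_realLegendre_le p n).trans ?_)
        simpa using Nat.floor_le (Real.exp_pos (Real.log p * u)).le
      · have : ⌊Real.exp (Real.log p * u)⌋₊ = 0 := by
          rw [Nat.floor_eq_zero, Real.exp_lt_one_iff]
          exact mul_neg_of_pos_of_neg hl (not_le.1 h)
        rw [this, Set.indicator_of_notMem (by simpa using h)]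
        simp
    · refine (integrable_indicator_iff measurableSet_Ici).2 ?_
      rw [integrableOn_Ici_iff_integrableOn_Ioi]
      simpa only [neg_mul] using integrableOn_exp_mul_Ioi (neg_lt_zero.2 hs) 0
    · filter_upwards [Measure.ae_ne volume 0] with u hu
      rcases lt_or_gt_of_ne hu with h | h
      · rw [Set.indicator_of_notMem (by simpa using h)]
        refine tendsto_const_nhds.congr' ?_
        filter_upwards [hpos] with p hp
        have : ⌊Real.exp (Real.log p * u)⌋₊ = 0 := by
          rw [Nat.floor_eq_zero, Real.exp_lt_one_iff]
          exact mul_neg_of_pos_of_neg (Real.log_pos hp) h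
        rw [this]
        simp
      · rw [Set.indicator_of_mem (Set.mem_Ici.2 h.le)]
        refine ((tendsto_mean_realLegendre h (hN u h.le)).mul_const _).congr' ?_
        filter_upwards [hpos] with p hp
        rw [Real.rpow_def_of_pos (by linarith), div_eq_mul_inv, ← Real.exp_neg, mul_assoc,
          ← Real.exp_add]
        ring_nf
  rw [integral_indicator measurableSet_Ici] at key
  rw [← integral_exp_mul_one_sub_cdf hκ h0 hi hs]
  have h1 : Tendsto (fun p : ℕ => s * (1 + s / Real.log p)) (atTop ⊓ 𝓟 P) (𝓝 s) := by
    have := ((hlog.const_div_atTop s).const_add 1).const_mul s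
    simpa using this
  refine (h1.mul key).congr' ?_
  filter_upwards [hpos] with p hp
  have hl : 0 < Real.log p := Real.log_pos hp
  rw [tsum_mul_rpow_eq_integral (abs_realLegendre_le p) hl hs]
  field_simp

/-! ### Limit of the Laplace transforms of the nonresidue primes. -/

open Classical in
theorem tendsto_tail_tsum {ι : Type*} {l : Filter ι} {B : ι → ℝ} (hB : Tendsto B l atTop) :
    Tendsto (fun a => ∑' q : ℕ, if B a ≤ (q : ℝ) then 2 * (q : ℝ) ^ (-2 : ℝ) else 0) l (𝓝 0) := by
  suffices h : Tendsto (fun a => ∑' q : ℕ, if B a ≤ (q : ℝ) then 2 * (q : ℝ) ^ (-2 : ℝ) else 0) l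
      (𝓝 (∑' _ : ℕ, (0 : ℝ))) by rwa [tsum_zero] at h
  refine tendsto_tsum_of_dominated_convergence
    ((Real.summable_nat_rpow.2 (show (-2 : ℝ) < -1 by norm_num)).mul_left 2) (fun q => ?_)
    (Eventually.of_forall fun a q => ?_)
  · refine tendsto_const_nhds.congr' ?_
    filter_upwards [hB.eventually_gt_atTop (q : ℝ)] with a ha
    rw [if_neg (not_le.2 ha)]
  · have : (0 : ℝ) ≤ 2 * (q : ℝ) ^ (-2 : ℝ) := by positivity
    split_ifs
    · rw [Real.norm_of_nonneg this]
    · simp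

theorem rpow_le_of_isNonresidueMod {p : ℕ} {κ : ℝ}
    (hn0 : (p : ℝ) ^ κ ≤ (leastNonresidue p : ℝ)) {q : ℕ} (hq : IsNonresidueMod p q) :
    (p : ℝ) ^ κ ≤ q := by
  refine hn0.trans (Nat.cast_le.2 (Nat.sInf_le ⟨Nat.pos_of_ne_zero ?_, hq⟩))
  rintro rfl
  exact not_dvd_of_isNonresidueMod hq (dvd_zero p)

theorem weight_mul_exp_eq (p q : ℕ) (s L : ℝ) :
    nonresiduePrimeWeight p q * Real.exp (-(s * (Real.log q / L))) =
      nonresiduePrimeWeight p q * (q : ℝ) ^ (1 - (1 + s / L)) := by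
  rcases Nat.eq_zero_or_pos q with rfl | hq
  · simp [nonresiduePrimeWeight, Nat.not_prime_zero]
  · rw [Real.rpow_def_of_pos (by exact_mod_cast hq)]
    congr 2
    ring

theorem tendsto_laplace_nonresiduePrimes {P : Set ℕ} (hP : ∀ p ∈ P, p.Prime) {d : ℝ → ℝ} {κ : ℝ}
    (hκ : 0 < κ) (hn0 : ∀ p ∈ P, (p : ℝ) ^ κ ≤ (leastNonresidue p : ℝ))
    (h0 : ∀ x < κ, d x = 0) (hd : ∀ x, 0 ≤ d x) (hi : Integrable d) (h1 : ∫ x, d x = 1)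
    (hN : ∀ θ : ℝ, 0 ≤ θ →
      Tendsto (fun p : ℕ => ((nonresiduesUpTo p ((p : ℝ) ^ θ)).card : ℝ) / (p : ℝ) ^ θ)
        (atTop ⊓ 𝓟 P) (𝓝 (halfCdf d θ))) {s : ℝ} (hs : 0 < s) :
    Tendsto (fun p : ℕ => ∑' q : ℕ, nonresiduePrimeWeight p q *
        Real.exp (-(s * (Real.log q / Real.log p))))
      (atTop ⊓ 𝓟 P) (𝓝 (∫ u, logConvDensity d u * Real.exp (-(s * u)))) := by
  classical
  have hnat : Tendsto (fun p : ℕ => (p : ℝ)) (atTop ⊓ 𝓟 P) atTop :=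
    tendsto_natCast_atTop_atTop.mono_left inf_le_left
  have hlog : Tendsto (fun p : ℕ => Real.log p) (atTop ⊓ 𝓟 P) atTop :=
    Real.tendsto_log_atTop.comp hnat
  have hpos : ∀ᶠ p : ℕ in atTop ⊓ 𝓟 P, 1 < (p : ℝ) := hnat.eventually_gt_atTop 1
  have hmem : ∀ᶠ p : ℕ in atTop ⊓ 𝓟 P, p ∈ P := mem_inf_of_right (mem_principal_self P)
  have hw : Tendsto (fun p : ℕ => 1 + s / Real.log p) (atTop ⊓ 𝓟 P) (𝓝[>] 1) := by
    refine tendsto_nhdsWithin_iff.2 ⟨?_, ?_⟩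
    · simpa using (hlog.const_div_atTop s).const_add 1
    · filter_upwards [hpos] with p hp
      have := Real.log_pos hp
      have : 0 < s / Real.log p := by positivity
      simpa using this
  -- The simple pole of zeta at `1`, with residue `1`.
  have hZ : Tendsto (fun p : ℕ => s / Real.log p * ∑' n : ℕ, (n : ℝ) ^ (-(1 + s / Real.log p)))
      (atTop ⊓ 𝓟 P) (𝓝 1) := by
    refine (tendsto_sub_mul_tsum_nat_rpow.comp hw).congr fun p => ?_
    simp only [Function.comp, add_sub_cancel_left]
    congr 2
    ext n
    rw [Real.rpow_neg n.cast_nonneg, one_div]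
  have hL := tendsto_L_div_log hκ h0 hi hN hs
  -- A nonzero limit allows taking logarithms; the factors `s / log p` then cancel in the
  -- difference.
  have hF : 0 < 1 - laplaceReal d s := sub_pos.2 (laplaceReal_lt_one hκ h0 hd hi h1 hs)
  have hdiff := (hZ.log one_ne_zero).sub (hL.log hF.ne')
  rw [Real.log_one, zero_sub] at hdiff
  have hErr : Tendsto (fun p : ℕ =>
      (∑' q : ℕ, if (p : ℝ) ^ κ ≤ (q : ℝ) then 2 * (q : ℝ) ^ (-2 : ℝ) else 0) + 2 / (p : ℝ))
      (atTop ⊓ 𝓟 P) (𝓝 0) := by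
    simpa using (tendsto_tail_tsum ((tendsto_rpow_atTop hκ).comp hnat)).add
      (hnat.const_div_atTop 2)
  have hsq := squeeze_zero_norm' (f := fun p : ℕ =>
    Real.log (∑' n : ℕ, (n : ℝ) ^ (-(1 + s / Real.log p))) -
    Real.log (∑' n : ℕ, realLegendre p n * (n : ℝ) ^ (-(1 + s / Real.log p))) -
    2 * ∑' q : ℕ, nonresiduePrimeWeight p q * (q : ℝ) ^ (1 - (1 + s / Real.log p))) (by
      filter_upwards [hpos, hmem] with p hp hpP
      have hl := Real.log_pos hp
      exact (abs_log_zeta_sub_log_L_le (hP p hpP)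
        (show 1 < 1 + s / Real.log p by simpa using div_pos hs hl) (B := (p : ℝ) ^ κ)
        fun q hq => rpow_le_of_isNonresidueMod (hn0 p hpP) hq).2) hErr
  rw [(integral_logConvDensity_mul_exp hκ h0 hd hi h1 hs).2]
  have hfin := (hdiff.sub hsq).const_mul (1 / 2)
  rw [sub_zero, mul_neg, ← neg_mul] at hfin
  refine hfin.congr' ?_
  filter_upwards [hpos, hmem, hZ.eventually_const_lt one_pos] with p hp hpP hz
  have hl := Real.log_pos hp
  have hsl : 0 < s / Real.log p := by positivity
  have hLpos := (abs_log_zeta_sub_log_L_le (hP p hpP) (w := 1 + s / Real.log p) (by linarith)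
    fun q hq => rpow_le_of_isNonresidueMod (hn0 p hpP) hq).1
  rw [Real.log_mul hsl.ne' (pos_of_mul_pos_right hz hsl.le).ne', Real.log_mul hsl.ne' hLpos.ne']
  simp only [weight_mul_exp_eq]
  ring

/-! ### Sums over nonresidue primes and Chebyshev's bound. -/

theorem nonresiduePrimeSum_eq (p : ℕ) (X : ℝ) :
    nonresiduePrimeSum p X = ∑ q ∈ Finset.Icc 1 ⌊X⌋₊, nonresiduePrimeWeight p q := by
  classical
  rw [nonresiduePrimeSum, nonresiduesUpTo, Finset.filter_filter, Finset.sum_filter]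
  refine Finset.sum_congr rfl fun q _ => ?_
  rw [nonresiduePrimeWeight]
  simp only [and_comm]

theorem tsum_weight_le_eq {p : ℕ} (hp : 1 < (p : ℝ)) (θ : ℝ) :
    (∑' q : ℕ, if Real.log q / Real.log p ≤ θ then nonresiduePrimeWeight p q else 0) =
      nonresiduePrimeSum p ((p : ℝ) ^ θ) := by
  have hl := Real.log_pos hp
  have hmem : ∀ q : ℕ, q ≠ 0 →
      (Real.log q / Real.log p ≤ θ ↔ q ∈ Finset.Icc 1 ⌊(p : ℝ) ^ θ⌋₊) := by
    intro q hq
    rw [Finset.mem_Icc, Nat.le_floor_iff (by positivity), div_le_iff₀ hl,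
      Real.log_le_iff_le_exp (by positivity), Real.rpow_def_of_pos (by linarith), mul_comm θ]
    exact ⟨fun h => ⟨Nat.one_le_iff_ne_zero.2 hq, h⟩, fun h => h.2⟩
  rw [nonresiduePrimeSum_eq, tsum_eq_sum (s := Finset.Icc 1 ⌊(p : ℝ) ^ θ⌋₊)]
  · refine Finset.sum_congr rfl fun q hq => if_pos ?_
    exact (hmem q (Nat.one_le_iff_ne_zero.1 (Finset.mem_Icc.1 hq).1)).2 hq
  · intro q hq
    rcases eq_or_ne q 0 with rfl | hq0
    · simp [nonresiduePrimeWeight, Nat.not_prime_zero]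
    · exact if_neg fun h => hq ((hmem q hq0).1 h)

/-- Abel summation of `log q / q` with `θ(x) ≤ x log 4`; then `log q > log X` allows dividing by
`log X`. -/
theorem sum_prime_inv_Ioc_le {X Y : ℝ} (hX : 1 < X) (hXY : X ≤ Y) :
    ∑ q ∈ Finset.Ioc ⌊X⌋₊ ⌊Y⌋₊, (if q.Prime then (q : ℝ)⁻¹ else 0) ≤
      Real.log 4 * (1 + Real.log (Y / X)) / Real.log X := by
  have hX0 : 0 < X := by linarith
  have hY0 : 0 < Y := by linarith
  have hl := Real.log_pos hX
  have h4 : 0 < Real.log 4 := Real.log_pos (by norm_num)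
  set c : ℕ → ℝ := fun k => if k.Prime then Real.log k else 0 with hc
  have hθ : ∀ x : ℝ, ∑ k ∈ Finset.Icc 0 ⌊x⌋₊, c k = Chebyshev.theta x := fun x => by
    rw [Chebyshev.theta_eq_sum_Icc, Finset.sum_filter]
  have hder : ∀ t ∈ Set.Icc X Y, HasDerivAt (fun t : ℝ => t⁻¹) (-(t ^ 2)⁻¹) t := fun t ht =>
    hasDerivAt_inv (by linarith [ht.1])
  have hcont : ContinuousOn (fun t : ℝ => -(t ^ 2)⁻¹) (Set.Icc X Y) := by
    refine (ContinuousOn.inv₀ (by fun_prop) fun t ht => ?_).neg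
    have : 0 < t := by linarith [ht.1]
    positivity
  have hint : IntegrableOn (deriv fun t : ℝ => t⁻¹) (Set.Icc X Y) :=
    (hcont.integrableOn_Icc).congr_fun (fun t ht => ((hder t ht).deriv).symm) measurableSet_Icc
  have habel := sum_mul_eq_sub_sub_integral_mul c hX0.le hXY
    (fun t ht => (hder t ht).differentiableAt) hint
  simp only [hθ] at habel
  have hmain : ∑ k ∈ Finset.Ioc ⌊X⌋₊ ⌊Y⌋₊, (k : ℝ)⁻¹ * c k ≤
      Real.log 4 * (1 + Real.log (Y / X)) := by
    rw [habel]
    have e1 : Y⁻¹ * Chebyshev.theta Y ≤ Real.log 4 := by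
      rw [inv_mul_le_iff₀ hY0, mul_comm]; exact Chebyshev.theta_le_log4_mul_x hY0.le
    have e2 : 0 ≤ X⁻¹ * Chebyshev.theta X :=
      mul_nonneg (by positivity) (Chebyshev.theta_nonneg X)
    have e3 : -∫ t in Set.Ioc X Y, deriv (fun t : ℝ => t⁻¹) t * Chebyshev.theta t ≤
        Real.log 4 * Real.log (Y / X) := by
      rw [← integral_inv_of_pos hX0 hY0, ← intervalIntegral.integral_const_mul,
        intervalIntegral.integral_of_le hXY, ← integral_neg]
      refine setIntegral_mono_on ?_ ?_ measurableSet_Ioc fun t ht => ?_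
      · have := integrableOn_mul_sum_Icc c (m := 0) hX0.le hint
        simp only [hθ] at this
        exact (this.mono_set Set.Ioc_subset_Icc_self).neg
      · refine (ContinuousOn.integrableOn_Icc ?_).mono_set Set.Ioc_subset_Icc_self
        exact continuousOn_const.mul (ContinuousOn.inv₀ continuousOn_id
          fun t ht => (hX0.trans_le ht.1).ne')
      · have ht0 : 0 < t := hX0.trans ht.1
        rw [(hder t (Set.Ioc_subset_Icc_self ht)).deriv, neg_mul, neg_neg]
        have := Chebyshev.theta_le_log4_mul_x ht0.le
        rw [inv_mul_le_iff₀ (by positivity)]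
        calc _ ≤ _ := this
          _ = _ := by field_simp
    linarith
  rw [le_div_iff₀ hl]
  refine le_trans ?_ hmain
  rw [Finset.sum_mul]
  refine Finset.sum_le_sum fun q hq => ?_
  have hq' : X < q := (Nat.floor_lt hX0.le).1 (Finset.mem_Ioc.1 hq).1
  simp only [hc]
  split_ifs
  · exact mul_le_mul_of_nonneg_left (Real.log_le_log hX0 hq'.le) (by positivity)
  · simp

theorem nonresiduePrimeSum_sub_le {p : ℕ} (hp : 1 < (p : ℝ)) {a b : ℝ} (ha : 0 < a) (hab : a ≤ b) :
    nonresiduePrimeSum p ((p : ℝ) ^ b) - nonresiduePrimeSum p ((p : ℝ) ^ a) ≤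
      Real.log 4 * (1 / Real.log p + (b - a)) / a := by
  have hp0 : 0 < (p : ℝ) := by linarith
  have hl := Real.log_pos hp
  have hXY : (p : ℝ) ^ a ≤ (p : ℝ) ^ b := Real.rpow_le_rpow_of_exponent_le hp.le hab
  have hfl : ⌊(p : ℝ) ^ a⌋₊ ≤ ⌊(p : ℝ) ^ b⌋₊ := Nat.floor_le_floor hXY
  have hIcc : ∀ N : ℕ, Finset.Icc 1 N = Finset.Ioc 0 N := fun N => rfl
  rw [nonresiduePrimeSum_eq, nonresiduePrimeSum_eq, hIcc, hIcc,
    ← Finset.sum_Ioc_consecutive _ (Nat.zero_le _) hfl, add_sub_cancel_left]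
  have h1 := sum_prime_inv_Ioc_le (Real.one_lt_rpow hp ha) hXY
  have h2 : ∑ q ∈ Finset.Ioc ⌊(p : ℝ) ^ a⌋₊ ⌊(p : ℝ) ^ b⌋₊, nonresiduePrimeWeight p q ≤
      ∑ q ∈ Finset.Ioc ⌊(p : ℝ) ^ a⌋₊ ⌊(p : ℝ) ^ b⌋₊, (if q.Prime then (q : ℝ)⁻¹ else 0) := by
    refine Finset.sum_le_sum fun q _ => ?_
    by_cases hq : q.Prime
    · rw [if_pos hq]; exact nonresiduePrimeWeight_le p q
    · simp [nonresiduePrimeWeight, hq]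
  refine (h2.trans h1).trans_eq ?_
  rw [Real.log_div (by positivity) (by positivity), Real.log_rpow hp0, Real.log_rpow hp0]
  field_simp

theorem integral_logConvDensity_le {P : Set ℕ} (hPinf : P.Infinite) {φ : ℝ → ℝ} {κ : ℝ}
    (hκ : 0 < κ) (hφ : ∀ θ, IntegrableOn φ (Set.Iic θ))
    (hlim : ∀ θ : ℝ, Tendsto (fun p : ℕ => nonresiduePrimeSum p ((p : ℝ) ^ θ)) (atTop ⊓ 𝓟 P)
      (𝓝 (∫ u in Set.Iic θ, φ u))) (a b : ℝ) (ha : κ ≤ a) (hab : a ≤ b) :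
    ∫ u in a..b, φ u ≤ Real.log 4 / κ * (b - a) := by
  -- Passing an inequality to the limit needs a nontrivial filter; this is the infinitude of `P`.
  have hne : (atTop ⊓ 𝓟 P).NeBot := by
    rw [← frequently_mem_iff_neBot, Nat.frequently_atTop_iff_infinite]
    exact hPinf
  have hnat : Tendsto (fun p : ℕ => (p : ℝ)) (atTop ⊓ 𝓟 P) atTop :=
    tendsto_natCast_atTop_atTop.mono_left inf_le_left
  have hlog : Tendsto (fun p : ℕ => Real.log p) (atTop ⊓ 𝓟 P) atTop :=
    Real.tendsto_log_atTop.comp hnat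
  have h4 : 0 < Real.log 4 := Real.log_pos (by norm_num)
  rw [← intervalIntegral.integral_Iic_sub_Iic (hφ a) (hφ b)]
  have h2 : Tendsto (fun p : ℕ => Real.log 4 * (1 / Real.log p + (b - a)) / a) (atTop ⊓ 𝓟 P)
      (𝓝 (Real.log 4 * (0 + (b - a)) / a)) :=
    (((hlog.const_div_atTop 1).add_const _).const_mul _).div_const _
  have h3 := le_of_tendsto_of_tendsto ((hlim b).sub (hlim a)) h2 (by
    filter_upwards [hnat.eventually_gt_atTop 1] with p hp
    exact nonresiduePrimeSum_sub_le hp (hκ.trans_le ha) hab)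
  refine h3.trans ?_
  rw [zero_add, div_mul_eq_mul_div]
  exact div_le_div_of_nonneg_left (mul_nonneg h4.le (by linarith)) hκ ha

/-! ### The main theorem. -/

theorem proposition4p13
    (κ lam : ℝ) (hκ : 0 < κ) (hκlam : κ ≤ lam / √(Real.exp 1))
    (hlam : lam / √(Real.exp 1) ≤ 1 / (4 * √(Real.exp 1)))
    -- the infinite set of odd primes
    (P : Set ℕ) (hPinf : P.Infinite) (hPodd : ∀ p ∈ P, p.Prime ∧ p ≠ 2)
    (hn0 : ∀ p ∈ P, (p : ℝ) ^ κ ≤ (leastNonresidue p : ℝ))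
    -- the probability density on `[κ, lam]`
    (d : ℝ → ℝ) (hd_nonneg : ∀ x, 0 ≤ d x) (hd_supp : ∀ x, x ∉ Set.Icc κ lam → d x = 0)
    (hd_int : Integrable d) (hd_one : ∫ x, d x = 1)
    (hd_smooth : ContDiffOn ℝ 2 d (Set.Ioo κ lam)) (hd_ends : d κ * d lam ≠ 0)
    -- the counting hypothesis, pointwise in `θ`
    (hN : ∀ θ : ℝ, 0 ≤ θ →
      Tendsto (fun p : ℕ => ((nonresiduesUpTo p ((p : ℝ) ^ θ)).card : ℝ) / (p : ℝ) ^ θ)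
        (atTop ⊓ 𝓟 P) (𝓝 (halfCdf d θ))) :
    ∃ S₁ : ℝ → ℝ,
      (∀ θ : ℝ, 0 ≤ θ →
        Tendsto (fun p : ℕ => nonresiduePrimeSum p ((p : ℝ) ^ θ)) (atTop ⊓ 𝓟 P) (𝓝 (S₁ θ))) ∧
      (∀ θ : ℝ, 0 ≤ θ →
        HasSum (fun n : ℕ => convWithPow (halfCdf d) d n θ / ((n : ℝ) + 1)) (S₁ θ)) ∧
      ContDiffOn ℝ 1 S₁ (Set.Ioi lam) ∧
      (∀ θ : ℝ, lam < θ →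
        Summable (fun n : ℕ => convPowSucc d n θ / ((n : ℝ) + 1)) ∧
        HasDerivAt S₁ ((1 / 2) * ∑' n : ℕ, convPowSucc d n θ / ((n : ℝ) + 1)) θ) := by
  have hlam0 : lam / √(Real.exp 1) ≤ lam := by
    have h1 : 0 < √(Real.exp 1) := Real.sqrt_pos.2 (Real.exp_pos 1)
    have h2 : 1 ≤ √(Real.exp 1) := Real.one_le_sqrt.2 (Real.one_le_exp zero_le_one)
    have h3 : 0 < lam := by
      have := hκ.trans_le hκlam
      rwa [div_pos_iff_of_pos_right h1] at this
    exact div_le_self h3.le h2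
  have hκl : κ ≤ lam := hκlam.trans hlam0
  have h0 : ∀ x < κ, d x = 0 := fun x hx => hd_supp x fun h => absurd h.1 (not_le.2 hx)
  have hlap := fun (s : ℝ) (hs : 0 < s) => tendsto_laplace_nonresiduePrimes
    (fun p hp => (hPodd p hp).1) hκ hn0 h0 hd_nonneg hd_int hd_one hN hs
  have hnat : Tendsto (fun p : ℕ => (p : ℝ)) (atTop ⊓ 𝓟 P) atTop :=
    tendsto_natCast_atTop_atTop.mono_left inf_le_left
  have hpos := hnat.eventually_gt_atTop 1
  have hlim : ∀ θ : ℝ, Tendsto (fun p : ℕ => nonresiduePrimeSum p ((p : ℝ) ^ θ)) (atTop ⊓ 𝓟 P)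
      (𝓝 (∫ u in Set.Iic θ, logConvDensity d u)) := by
    intro θ
    refine (tendsto_tsum_le_of_laplace (W := nonresiduePrimeWeight)
      (v := fun p q => Real.log q / Real.log p)
      (Eventually.of_forall fun p q => nonresiduePrimeWeight_nonneg p q) ?_ ?_
      (fun u hu => logConvDensity_eq_zero h0 hκ (hu.trans hκ)) ?_ hlap θ).congr' ?_
    · filter_upwards [hpos] with p hp q
      exact div_nonneg (Real.log_natCast_nonneg q) (Real.log_pos hp).le
    · filter_upwards [hpos] with p hp
      have hl := Real.log_pos hp
      refine (summable_weight_mul_rpow p (show 1 < 1 + 1 / Real.log p by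
        simpa using hl)).congr fun q => ?_
      simpa using (weight_mul_exp_eq p q 1 (Real.log p)).symm
    · simpa using (integral_logConvDensity_mul_exp hκ h0 hd_nonneg hd_int hd_one one_pos).1
    · filter_upwards [hpos] with p hp
      exact tsum_weight_le_eq hp θ
  have hφ := integrableOn_logConvDensity hκ h0 hd_nonneg hd_int hd_one
  have hdc := hd_smooth.continuousOn
  -- Inside the interval the bound comes from the primes, as `d` could a priori blow up towards the
  -- ends; the two end values are added separately.
  obtain ⟨M, hM⟩ : ∃ M, ∀ x, |d x| ≤ M := by
    have hb := fun x hx => le_of_integral_logConvDensity_le (x := x) hκ h0 hd_nonneg hd_int hd_one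
      hdc (integral_logConvDensity_le hPinf hκ hφ hlim) hx
    refine ⟨max (2 * (Real.log 4 / κ)) (max (d κ) (d lam)), fun x => ?_⟩
    rw [abs_of_nonneg (hd_nonneg x)]
    by_cases hx : x ∈ Set.Icc κ lam
    · rcases eq_or_lt_of_le hx.1 with h | h
      · subst h; simp
      · rcases eq_or_lt_of_le hx.2 with h' | h'
        · subst h'; simp
        · exact (hb x ⟨h, h'⟩).trans (le_max_left _ _)
    · rw [hd_supp x hx]
      exact le_max_of_le_right (le_max_of_le_left (hd_nonneg κ))
  have hcont : ∀ θ, lam < θ → ContinuousAt (logConvDensity d) θ := fun θ hθ =>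
    continuousAt_logConvDensity hκ hd_int hd_supp hdc hM hθ
  have hderiv : ∀ θ, lam < θ →
      HasDerivAt (fun θ => ∫ u in Set.Iic θ, logConvDensity d u) (logConvDensity d θ) θ := by
    intro θ hθ
    -- The integrals from `-∞` and from `0` differ by a constant, so the fundamental theorem of
    -- calculus applies at the continuity point `θ`.
    have h2 : HasDerivAt (fun θ => ∫ u in (0 : ℝ)..θ, logConvDensity d u) (logConvDensity d θ) θ := by
      refine intervalIntegral.integral_hasDerivAt_right ?_ ?_ (hcont θ hθ)
      · exact intervalIntegrable_iff.2 ((hφ (max 0 θ)).mono_set fun u hu =>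
          (Set.mem_Icc.1 (Set.uIoc_subset_uIcc hu)).2)
      · exact ⟨Set.Iic (θ + 1), Iic_mem_nhds (by linarith), (hφ (θ + 1)).aestronglyMeasurable⟩
    refine (h2.const_add (∫ u in Set.Iic (0 : ℝ), logConvDensity d u)).congr_of_eventuallyEq
      (Eventually.of_forall fun y => ?_)
    simp only
    rw [← intervalIntegral.integral_Iic_sub_Iic (hφ 0) (hφ y)]
    ring
  refine ⟨fun θ => ∫ u in Set.Iic θ, logConvDensity d u, fun θ _ => hlim θ, fun θ _ => ?_, ?_,
    fun θ hθ => ⟨summable_convPowSucc hκ h0 θ, hderiv θ hθ⟩⟩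
  · simp only [convWithPow_halfCdf hκ h0 hd_int]
    exact hasSum_setIntegral_convPowSucc hκ h0 hd_int θ
  · rw [show (1 : WithTop ℕ∞) = 0 + 1 by norm_num, contDiffOn_succ_iff_deriv_of_isOpen isOpen_Ioi]
    refine ⟨fun θ hθ => (hderiv θ hθ).differentiableAt.differentiableWithinAt, by simp, ?_⟩
    rw [contDiffOn_zero]
    exact ContinuousOn.congr (fun θ hθ => (hcont θ hθ).continuousWithinAt)
      fun θ hθ => (hderiv θ hθ).deriv
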